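/- Let $(R,\mathfrak m)$ be a regular local ring of dimension $n$ and of prime characteristic $p$, with regular system of parameters $x_1,\dots,x_n$. Let $$E=H^n_{\mathfrak m}(R)=R_{x_1\cdots x_n}\Big/\sum_{i}R_{x_1\cdots\widehat{x_i}\cdots x_n},$$ with its Frobenius map $F_E([u/(x_1\cdots x_n)^d])=[u^p/(x_1\cdots x_n)^{pd}]$. Let $0\neq f\in\mathfrak m$ and, for $r\ge 0$, $e\geq 1$, put $Z_{r,e}=\{w\in E\mid hF_E^e(w)=0\text{ for all }h\in (f)^r\}$. For ideals $\mathfrak a, J$ of $R$ with $\mathfrak a\subseteq \mathrm{Rad}(J)\subseteq\mathfrak m$ write $J^{[q]}=(y^q\mid y\in J)$, $\nu^J_{\mathfrak a}(q)=\max\{r\mid \mathfrak a^r\not\subseteq J^{[q]}\}$, and let $c^J(\mathfrak a)=\lim_{e\to\infty}\nu^J_{\mathfrak a}(p^e)/p^e$ be the F-threshold, with $c^R(\mathfrak a)=0$; write $c^J(f)=c^J((f))$. A test ideal of $(f)$ is an ideal of the form $\tau(f^c)=\mathrm{Ann}_R\big(\bigcap_{e\ge1}Z_{\lceil cp^e\rceil,e}\big)$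 with $c\in\mathbb R_{\ge0}$. The submodules $Z_{r,e}$ of $E$ are pairwise comparable, and the submodules $M_0,M_1,M_2,\dots$ of $E$, where $M_m$ is the least element of $\{Z_{r,e}\mid r\geq 0,e\geq 1\}\smallsetminus\{M_0,\dots,M_{m-1}\}$, are well defined for all $m\ge 0$, with $M_0=0$ and $M_0\subsetneq M_1\subsetneq M_2\subsetneq\cdots$. Put $J_i=\mathrm{Ann}_R(M_i)$ and $c_i=c^{J_i}(f)$. Then $J_0=R$, so $c_0=0$, and for $i\ge1$ one has $f\in\mathrm{Rad}(J_i)\subseteq\mathfrak m$, so that the numbers $\nu^{J_i}_{(f)}(p^e)$ and $c_i$ are well defined. For $i,e\ge1$ there is a largest $r$ such that $Z_{r,e}\subseteq M_{i-1}$; denote it by $\nu_i(e)$. Moreover: 1. If the Frobenius morphism of $R$ is finite, or if $R$ is complete, then $c_i=\lim_{e\to\infty}\nu_i(e)/p^e$ for every $i\geq 1$. 2. Every $J_i$ is a test ideal of $(f)$, and if $J$ is any test ideal of $(f)$ different from all the $J_i$, then $J$ is contained in all the $J_i$. -/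

import Mathlib

open Filter Topology IsLocalRing

namespace FThresh

noncomputable section

/-! ### Frobenius powers and F-thresholds -/

/-- The Frobenius power `J^{[q]}`, generated by the `q`-th powers of the elements of `J`. -/
def frobPower {R : Type*} [CommRing R] (J : Ideal R) (q : ℕ) : Ideal R :=
  Ideal.span ((fun y : R => y ^ q) '' (J : Set R))

/-- `ν_𝔞^J(q) = max {r | 𝔞^r ⊄ J^{[q]}}`. For `J = R` the set is empty and the value is `0`. -/
def nu {R : Type*} [CommRing R] (𝔞 J : Ideal R) (q : ℕ) : ℕ :=
  sSup {r : ℕ | ¬ 𝔞 ^ r ≤ frobPower J q}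

/-- The F-threshold `c^J(𝔞) = lim_e ν_𝔞^J(p^e) / p^e`. -/
def fThreshold {R : Type*} [CommRing R] (p : ℕ) (𝔞 J : Ideal R) : ℝ :=
  limUnder atTop (fun e : ℕ => (nu 𝔞 J (p ^ e) : ℝ) / (p : ℝ) ^ e)

/-! ### The top local cohomology module and its Frobenius -/

/-- The ring `R_{x_1 ⋯ x_n}`. -/
abbrev LocProd {R : Type*} [CommRing R] {n : ℕ} (x : Fin n → R) : Type _ :=
  Localization.Away (∏ i, x i)

/-- The image of `R_{x_1 ⋯ x̂_i ⋯ x_n}` in `R_{x_1 ⋯ x_n}`: the fractions `a / y^d` with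
`y = ∏_{j ≠ i} x_j` (note that `y` is a unit of `R_{x_1 ⋯ x_n}`). -/
def locImage {R : Type*} [CommRing R] {n : ℕ} (x : Fin n → R) (i : Fin n) :
    Submodule R (LocProd x) where
  carrier := {s | ∃ (a : R) (d : ℕ),
    algebraMap R (LocProd x) ((∏ j ∈ Finset.univ.erase i, x j) ^ d) * s =
      algebraMap R (LocProd x) a}
  zero_mem' := ⟨0, 0, by simp⟩
  add_mem' := by
    rintro s t ⟨a, d, hs⟩ ⟨b, k, ht⟩
    refine ⟨(∏ j ∈ Finset.univ.erase i, x j) ^ k * a +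
      (∏ j ∈ Finset.univ.erase i, x j) ^ d * b, d + k, ?_⟩
    rw [map_add, map_mul, map_mul, ← hs, ← ht, pow_add, map_mul]
    ring
  smul_mem' := by
    rintro c s ⟨a, d, hs⟩
    refine ⟨c * a, d, ?_⟩
    rw [Algebra.smul_def, map_mul, ← hs]
    ring

/-- The submodule `∑_i R_{x_1 ⋯ x̂_i ⋯ x_n}` of `R_{x_1 ⋯ x_n}`. -/
def locBoundary {R : Type*} [CommRing R] {n : ℕ} (x : Fin n → R) : Submodule R (LocProd x) :=
  ⨆ i, locImage x i

/-- `E = R_{x_1 ⋯ x_n} / ∑_i R_{x_1 ⋯ x̂_i ⋯ x_n}`, the top cohomology of the Čech complex of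
`x_1, …, x_n`; this is `H^n_𝔪(R)` when `x_1, …, x_n` is a system of parameters of a local
ring `(R, 𝔪)`. -/
abbrev TopCoh {R : Type*} [CommRing R] {n : ℕ} (x : Fin n → R) : Type _ :=
  LocProd x ⧸ locBoundary x

/-- The Frobenius `s ↦ s^p` of `R_{x_1 ⋯ x_n}`, as a map semilinear over the Frobenius of `R`. -/
def frobLoc {R : Type*} [CommRing R] (p : ℕ) [Fact p.Prime] [CharP R p] {n : ℕ}
    (x : Fin n → R) : LocProd x →ₛₗ[frobenius R p] LocProd x where
  toFun s := s ^ p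
  map_add' s t := by
    obtain ⟨r, hr⟩ := exists_add_pow_prime_eq (Fact.out : p.Prime) s t
    have h0 : (p : LocProd x) = 0 := by
      rw [← map_natCast (algebraMap R (LocProd x)), CharP.cast_eq_zero, map_zero]
    rw [hr, h0]
    ring
  map_smul' c s := by
    rw [Algebra.smul_def, Algebra.smul_def, mul_pow, frobenius_def, map_pow]

theorem locBoundary_le_comap {R : Type*} [CommRing R] (p : ℕ) [Fact p.Prime] [CharP R p] {n : ℕ}
    (x : Fin n → R) : locBoundary x ≤ (locBoundary x).comap (frobLoc p x) := by
  refine iSup_le fun i => ?_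
  rintro s ⟨a, d, hs⟩
  refine (le_iSup (locImage x) i) ⟨a ^ p, d * p, ?_⟩
  change _ * s ^ p = _
  rw [pow_mul, map_pow, ← mul_pow, hs, map_pow]

/-- The Frobenius morphism `F_E : E → E`,
`[u / (x_1 ⋯ x_n)^d] ↦ [u^p / (x_1 ⋯ x_n)^{pd}]`. -/
def frobE {R : Type*} [CommRing R] (p : ℕ) [Fact p.Prime] [CharP R p] {n : ℕ}
    (x : Fin n → R) : TopCoh x →ₛₗ[frobenius R p] TopCoh x :=
  Submodule.mapQ _ _ (frobLoc p x) (locBoundary_le_comap p x)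

theorem frobE_iterate_zero {R : Type*} [CommRing R] (p : ℕ) [Fact p.Prime] [CharP R p] {n : ℕ}
    (x : Fin n → R) (e : ℕ) : (frobE p x)^[e] 0 = 0 := by
  induction e with
  | zero => rfl
  | succ k ih => rw [Function.iterate_succ_apply, map_zero, ih]

theorem frobE_iterate_add {R : Type*} [CommRing R] (p : ℕ) [Fact p.Prime] [CharP R p] {n : ℕ}
    (x : Fin n → R) (e : ℕ) (v w : TopCoh x) :
    (frobE p x)^[e] (v + w) = (frobE p x)^[e] v + (frobE p x)^[e] w := by
  induction e generalizing v w with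
  | zero => rfl
  | succ k ih => simp only [Function.iterate_succ_apply, map_add, ih]

theorem frobE_iterate_smul {R : Type*} [CommRing R] (p : ℕ) [Fact p.Prime] [CharP R p] {n : ℕ}
    (x : Fin n → R) (e : ℕ) (c : R) (w : TopCoh x) :
    (frobE p x)^[e] (c • w) = c ^ p ^ e • (frobE p x)^[e] w := by
  induction e generalizing c w with
  | zero => simp
  | succ k ih =>
    rw [Function.iterate_succ_apply, Function.iterate_succ_apply, LinearMap.map_smulₛₗ, ih,
      frobenius_def, ← pow_mul, pow_succ' p k]

/-- `Z_{r,e} = {w ∈ E | h F_E^e(w) = 0 for all h ∈ 𝔞^r}`. -/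
def Z {R : Type*} [CommRing R] (p : ℕ) [Fact p.Prime] [CharP R p] {n : ℕ} (x : Fin n → R)
    (𝔞 : Ideal R) (r e : ℕ) : Submodule R (TopCoh x) where
  carrier := {w | ∀ h ∈ 𝔞 ^ r, h • (frobE p x)^[e] w = 0}
  zero_mem' := fun h _ => by rw [frobE_iterate_zero, smul_zero]
  add_mem' := fun {v w} hv hw h hh => by
    rw [frobE_iterate_add, smul_add, hv h hh, hw h hh, add_zero]
  smul_mem' := fun c w hw h hh => by
    rw [frobE_iterate_smul, smul_comm, hw h hh, smul_zero]

/-- The test ideal `τ(𝔞^c) = Ann_R (⋂_{e ≥ 1} Z_{⌈c p^e⌉, e})`. -/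
def testIdeal {R : Type*} [CommRing R] (p : ℕ) [Fact p.Prime] [CharP R p] {n : ℕ}
    (x : Fin n → R) (𝔞 : Ideal R) (c : ℝ) : Ideal R :=
  (⨅ (e : ℕ) (_ : 1 ≤ e), Z p x 𝔞 ⌈c * (p : ℝ) ^ e⌉₊ e).annihilator

/-- `J` is a test ideal of `𝔞`: `J = τ(𝔞^c)` for some real `c ≥ 0`. -/
def IsTestIdeal {R : Type*} [CommRing R] (p : ℕ) [Fact p.Prime] [CharP R p] {n : ℕ}
    (x : Fin n → R) (𝔞 J : Ideal R) : Prop :=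
  ∃ c : ℝ, 0 ≤ c ∧ J = testIdeal p x 𝔞 c

/-! ### The chain of submodules attached to a principal ideal -/

/-- The family `{Z_{r,e} | r ≥ 0, e ≥ 1}` for `𝔞 = (f)`. -/
def family {R : Type*} [CommRing R] (p : ℕ) [Fact p.Prime] [CharP R p] {n : ℕ}
    (x : Fin n → R) (f : R) : Set (Submodule R (TopCoh x)) :=
  {N | ∃ r e : ℕ, 1 ≤ e ∧ N = Z p x (Ideal.span {f}) r e}

/-- `M_m`, the least member of the family different from `M_0, …, M_{m-1}`. It is written as an
intersection; that the least member exists is part of the theorem. -/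
def M {R : Type*} [CommRing R] (p : ℕ) [Fact p.Prime] [CharP R p] {n : ℕ}
    (x : Fin n → R) (f : R) (m : ℕ) : Submodule R (TopCoh x) :=
  sInf {N | N ∈ family p x f ∧ ∀ j : Fin m, N ≠ M p x f j}
termination_by m
decreasing_by exact j.isLt

/-- `J_i = Ann_R(M_i)`. -/
def J {R : Type*} [CommRing R] (p : ℕ) [Fact p.Prime] [CharP R p] {n : ℕ}
    (x : Fin n → R) (f : R) (i : ℕ) : Ideal R :=
  (M p x f i).annihilator

/-- `ν_i(e)`, the largest `r` with `Z_{r,e} ⊆ M_{i-1}` (used for `i ≥ 1`). -/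
def nuChain {R : Type*} [CommRing R] (p : ℕ) [Fact p.Prime] [CharP R p] {n : ℕ}
    (x : Fin n → R) (f : R) (i e : ℕ) : ℕ :=
  sSup {r : ℕ | Z p x (Ideal.span {f}) r e ≤ M p x f (i - 1)}

end

end FThresh

/-! The Frobenius of `E` is injective because it does not kill the socle generator `gen x 1`. Hence
Z_{r,e} = Z_{r p^k, e+k}, so a member depends only on r/p^e and the family is a chain. `E` is
Artinian (`isArtinian_topCoh`), so nonempty subfamilies have least members. The Z_{r,e} with e fixed
exhaust `E` but none equals `E`, so there is no greatest member and the M_m never run out.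

For claim 1, Z_{r,e} ⊆ M_{i-1} fails exactly when M_i ⊆ Z_{r,e}, that is, when f^r kills F^e(M_i).
If M_i is the full annihilator of J_i in `E`, this means f^r ∈ J_i^{[p^e]}, by the duality
`mem_frobPower_of_forall_annE`: whatever kills F^e(Ann_E I) lies in I^{[p^e]}. It is proved by
induction on colength from colon computations with powers of the parameters. Then ν_i(e) =
ν^{J_i}(p^e) for e ≥ 1 (`nuChain_eq_nu`). The equality M_i = Ann_E(J_i) is where F-finiteness or
completeness enters.

For claim 2, the intersection defining a test ideal is a decreasing one and stabilizes in `E`, so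
test ideals are exactly the annihilators of members of the family (`isTestIdeal_iff`); minimality of
M_i gives the rest. -/

namespace FThresh

noncomputable section

/-! ### Regular local rings are domains -/

section RegularLocal

universe u

/-- Cutting by A lowers the dimension by at most |A|, while the image of B generates the maximal
ideal of the quotient; dimension and embedding dimension are squeezed to |B|. -/
theorem isRegularLocalRing_quotient_span {R : Type u} [CommRing R] [IsLocalRing R]
    [IsNoetherianRing R] (A B : Finset R)
    (hAB : Ideal.span (A : Set R) ⊔ Ideal.span (B : Set R) = maximalIdeal R)
    (hdim : ((A.card + B.card : ℕ) : WithBot ℕ∞) ≤ ringKrullDim R) :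
    IsRegularLocalRing (R ⧸ Ideal.span (A : Set R)) ∧
      ringKrullDim (R ⧸ Ideal.span (A : Set R)) = (B.card : ℕ) := by
  classical
  have hA : Ideal.span (A : Set R) ≤ maximalIdeal R := hAB ▸ le_sup_left
  have : Nontrivial (R ⧸ Ideal.span (A : Set R)) :=
    Ideal.Quotient.nontrivial_iff.mpr
      (ne_top_of_le_ne_top (Ideal.IsPrime.ne_top inferInstance) hA)
  have hloc : IsLocalRing (R ⧸ Ideal.span (A : Set R)) :=
    .of_surjective' (Ideal.Quotient.mk _) Ideal.Quotient.mk_surjective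
  have hmax : maximalIdeal (R ⧸ Ideal.span (A : Set R)) =
      Ideal.span ((B.image (Ideal.Quotient.mk (Ideal.span (A : Set R))) : Finset _) : Set _) := by
    rw [← map_maximalIdeal_of_surjective (Ideal.Quotient.mk (Ideal.span (A : Set R)))
      Ideal.Quotient.mk_surjective, ← hAB, Ideal.map_sup, Ideal.map_quotient_self, bot_sup_eq,
      Ideal.map_span, Finset.coe_image]
  have hrank : (maximalIdeal (R ⧸ Ideal.span (A : Set R))).spanFinrank ≤ B.card := by
    rw [hmax]
    refine (Submodule.spanFinrank_span_le_ncard_of_finite (Finset.finite_toSet _)).trans ?_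
    rw [Set.ncard_coe_finset]
    exact Finset.card_image_le
  have hle : ringKrullDim (R ⧸ Ideal.span (A : Set R)) ≤ (B.card : ℕ) :=
    (ringKrullDim_le_spanFinrank_maximalIdeal _).trans (by exact_mod_cast hrank)
  have hge : ((B.card : ℕ) : WithBot ℕ∞) ≤ ringKrullDim (R ⧸ Ideal.span (A : Set R)) := by
    have h1 := ringKrullDim_le_ringKrullDim_quotient_add_encard (A : Set R)
      (Ideal.span_le.mp (hA.trans (IsLocalRing.ringJacobson_eq_maximalIdeal R).ge))
    rw [Set.encard_coe_eq_coe_finsetCard] at h1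
    have h2 := hdim.trans h1
    have hb : ringKrullDim (R ⧸ Ideal.span (A : Set R)) ≠ ⊥ := ringKrullDim_ne_bot
    obtain ⟨t, ht⟩ := WithBot.ne_bot_iff_exists.mp hb
    rw [← ht] at h2 ⊢
    have h3 : ((A.card + B.card : ℕ) : ℕ∞) ≤ t + (A.card : ℕ∞) := by exact_mod_cast h2
    have h4 : ((B.card : ℕ) : ℕ∞) ≤ t := by
      induction t using ENat.recTopCoe with
      | top => exact le_top
      | coe t => norm_cast at h3 ⊢; omega
    exact_mod_cast h4
  exact ⟨.of_spanFinrank_maximalIdeal_le _ (le_trans (by exact_mod_cast hrank) hge),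
    le_antisymm hle hge⟩

theorem exists_mem_maximalIdeal_notMem_sq_notMem_minimalPrimes {R : Type u} [CommRing R]
    [IsLocalRing R] [IsNoetherianRing R] (h : 0 < ringKrullDim R) :
    ∃ y ∈ maximalIdeal R, y ∉ maximalIdeal R ^ 2 ∧ ∀ P ∈ minimalPrimes R, y ∉ P := by
  classical
  by_contra! hcon
  have hfin := minimalPrimes.finite_of_isNoetherianRing R
  have hmin : maximalIdeal R ∉ minimalPrimes R := by
    intro hm
    rw [← Ideal.height_eq_zero_iff] at hm
    rw [← maximalIdeal_height_eq_ringKrullDim, hm] at h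
    exact lt_irrefl _ h
  have hsub : ((maximalIdeal R : Ideal R) : Set R) ⊆
      ⋃ i ∈ ((insert (maximalIdeal R ^ 2) hfin.toFinset : Finset (Ideal R)) : Set (Ideal R)),
        ((id i : Ideal R) : Set R) := by
    intro y hy
    by_cases hy2 : y ∈ maximalIdeal R ^ 2
    · exact Set.mem_biUnion (x := maximalIdeal R ^ 2) (by simp) hy2
    · obtain ⟨P, hP, hyP⟩ := hcon y hy hy2
      exact Set.mem_biUnion (x := P) (by simp [hP]) hyP
  -- Prime avoidance tolerates two non-prime members; 𝔪² fills both places. Nakayama and positive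
  -- dimension then exclude 𝔪 ≤ 𝔪² and 𝔪 minimal.
  obtain ⟨I, hI, hle⟩ := (Ideal.subset_union_prime (maximalIdeal R ^ 2) (maximalIdeal R ^ 2)
    (fun I hI h1 _ => by
      rcases Finset.mem_insert.mp hI with h | h
      · exact absurd h h1
      · exact Ideal.IsMinimalPrime.isPrime (hfin.mem_toFinset.mp h))).mp hsub
  rcases Finset.mem_insert.mp hI with rfl | hI
  · have hbot : maximalIdeal R = ⊥ := by
      refine Submodule.eq_bot_of_le_smul_of_le_jacobson_bot (maximalIdeal R) _
        (IsNoetherian.noetherian _) ?_ (maximalIdeal_le_jacobson _)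
      rw [smul_eq_mul, ← sq]
      exact hle
    have hF : IsField R := IsLocalRing.isField_iff_maximalIdeal_eq.mpr hbot
    rw [ringKrullDim_eq_zero_of_isField hF] at h
    exact lt_irrefl _ h
  · have hI' := hfin.mem_toFinset.mp hI
    have := Ideal.IsMinimalPrime.isPrime hI'
    exact hmin ((le_antisymm hle (le_maximalIdeal this.ne_top)) ▸ hI')

/-- For y outside 𝔪² and all minimal primes, R/(y) is regular of smaller dimension, so (y) is prime
by induction. A minimal prime P ⊆ (y) not containing y satisfies P = yP, and Nakayama gives P = 0.
-/
theorem isDomain_of_isRegularLocalRing_of_ringKrullDim_eq (k : ℕ) :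
    ∀ (R : Type u) [CommRing R] [IsRegularLocalRing R], ringKrullDim R = k → IsDomain R := by
  classical
  induction k with
  | zero =>
    intro R _ _ hk
    have h0 := IsRegularLocalRing.spanFinrank_maximalIdeal (R := R)
    rw [hk] at h0
    have h1 : (maximalIdeal R).spanFinrank = 0 := by exact_mod_cast h0
    rw [Submodule.spanFinrank_eq_zero_iff_eq_bot (IsNoetherian.noetherian _)] at h1
    exact (IsLocalRing.isField_iff_maximalIdeal_eq.mpr h1).isDomain
  | succ k ih =>
    intro R _ _ hk
    obtain ⟨y, hy, hy2, hyP⟩ := exists_mem_maximalIdeal_notMem_sq_notMem_minimalPrimes (R := R)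
      (by rw [hk]; exact_mod_cast k.succ_pos)
    obtain ⟨s, hs, hspan⟩ := Submodule.FG.exists_span_finset_card_eq_spanFinrank
      (IsNoetherian.noetherian (maximalIdeal R))
    have h0 := IsRegularLocalRing.spanFinrank_maximalIdeal (R := R)
    rw [hk] at h0
    have hcard : s.card = k + 1 := by rw [hs]; exact_mod_cast h0
    have hsm : ∀ i ∈ s, i ∈ maximalIdeal R := fun i hi => hspan ▸ Submodule.subset_span hi
    have hy' := hy
    rw [← hspan, Submodule.mem_span_finset] at hy'
    obtain ⟨a, -, ha⟩ := hy'
    -- Since y ∉ 𝔪², some coefficient of y is a unit, so y can replace that generator in a minimal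
    -- generating set.
    obtain ⟨i, hi, hai⟩ : ∃ i ∈ s, a i ∉ maximalIdeal R := by
      by_contra! hcon
      refine hy2 (ha ▸ Ideal.sum_mem _ fun i hi => ?_)
      rw [sq, smul_eq_mul]
      exact Ideal.mul_mem_mul (hcon i hi) (hsm i hi)
    have hu : IsUnit (a i) := by simpa using hai
    have hiy : i ∈ Ideal.span (({y} : Finset R) : Set R) ⊔
        Ideal.span ((s.erase i : Finset R) : Set R) := by
      have h1 : a i * i = y - ∑ j ∈ s.erase i, a j • j := by
        rw [← ha, ← Finset.add_sum_erase s _ hi, add_sub_cancel_right, smul_eq_mul]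
      rw [← Ideal.unit_mul_mem_iff_mem _ hu, h1]
      refine Ideal.sub_mem _ (Ideal.mem_sup_left (Ideal.subset_span (by simp)))
        (Ideal.mem_sup_right (Ideal.sum_mem _ fun j hj => ?_))
      exact Ideal.mul_mem_left _ _ (Ideal.subset_span hj)
    obtain ⟨hreg, hdim⟩ := isRegularLocalRing_quotient_span {y} (s.erase i)
      (by
        refine le_antisymm (sup_le ?_ ?_) ?_
        · simpa [Ideal.span_le] using hy
        · exact Ideal.span_le.mpr fun j hj => hsm j (Finset.mem_of_mem_erase hj)
        · rw [← hspan]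
          refine Submodule.span_le.mpr fun j hj => ?_
          by_cases hji : j = i
          · exact hji ▸ hiy
          · exact Ideal.mem_sup_right (Ideal.subset_span (by simpa [hji] using hj)))
      (by
        rw [hk, Finset.card_singleton, Finset.card_erase_of_mem hi, hcard]
        exact_mod_cast (by omega))
    rw [Finset.card_erase_of_mem hi, hcard] at hdim
    have hdom := ih _ hdim
    have hprime : (Ideal.span (({y} : Finset R) : Set R)).IsPrime :=
      (Ideal.Quotient.isDomain_iff_prime _).mp hdom
    obtain ⟨P, hPmin, hP⟩ := Ideal.exists_minimalPrimes_le
      (I := ⊥) (J := Ideal.span (({y} : Finset R) : Set R)) bot_le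
    have hPp := Ideal.IsMinimalPrime.isPrime hPmin
    have hbot : P = ⊥ := by
      refine Submodule.eq_bot_of_le_smul_of_le_jacobson_bot (Ideal.span {y}) P
        (IsNoetherian.noetherian _) (fun z hz => ?_)
        (le_trans (by simpa [Ideal.span_le] using hy) (maximalIdeal_le_jacobson _))
      have hz' := hP hz
      rw [Finset.coe_singleton, Ideal.mem_span_singleton'] at hz'
      obtain ⟨t, rfl⟩ := hz'
      have ht : t ∈ P := (hPp.mem_or_mem hz).resolve_right (hyP P hPmin)
      rw [smul_eq_mul, mul_comm]
      exact Ideal.mul_mem_mul ht (Ideal.mem_span_singleton_self y)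
    subst hbot
    exact IsDomain.of_bot_isPrime R

theorem isDomain_of_isRegularLocalRing (R : Type u) [CommRing R] [IsRegularLocalRing R] :
    IsDomain R :=
  isDomain_of_isRegularLocalRing_of_ringKrullDim_eq _ R
    IsRegularLocalRing.spanFinrank_maximalIdeal.symm

end RegularLocal

/-! ### Ideals generated by subsets of the parameters -/

section SystemOfParameters

variable {R : Type*} [CommRing R] [IsLocalRing R] [IsNoetherianRing R] {n : ℕ} {x : Fin n → R}

theorem injective_of_span_range_eq_maximalIdeal (hn : ringKrullDim R = n)
    (hx : Ideal.span (Set.range x) = maximalIdeal R) : Function.Injective x := by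
  classical
  have h1 := ringKrullDim_le_spanFinrank_maximalIdeal R
  rw [hn, ← hx] at h1
  have h2 : (Ideal.span (Set.range x)).spanFinrank ≤ (Set.range x).ncard :=
    Submodule.spanFinrank_span_le_ncard_of_finite (Set.finite_range x)
  have h3 : n ≤ (Finset.univ.image x).card := by
    have h4 : n ≤ (Ideal.span (Set.range x)).spanFinrank := by exact_mod_cast h1
    refine h4.trans (h2.trans (le_of_eq ?_))
    rw [← Set.ncard_coe_finset, Finset.coe_image, Finset.coe_univ, Set.image_univ]
  have h5 : (Finset.univ.image x).card = (Finset.univ : Finset (Fin n)).card :=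
    le_antisymm Finset.card_image_le (by simpa using h3)
  exact fun a b hab => Finset.card_image_iff.mp h5 (by simp) (by simp) hab

theorem ringKrullDim_quotient_span_image (hn : ringKrullDim R = n)
    (hx : Ideal.span (Set.range x) = maximalIdeal R) (S : Finset (Fin n)) :
    IsRegularLocalRing (R ⧸ Ideal.span (x '' S)) ∧
      ringKrullDim (R ⧸ Ideal.span (x '' S)) = (n - S.card : ℕ) := by
  classical
  have hinj := injective_of_span_range_eq_maximalIdeal hn hx
  have hle : S.card ≤ n := by simpa using S.card_le_univ
  have := isRegularLocalRing_quotient_span (S.image x) (Sᶜ.image x)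
    (by
      rw [← Ideal.span_union, Finset.coe_image, Finset.coe_image, ← Set.image_union,
        ← Finset.coe_union, Finset.union_compl, Finset.coe_univ, Set.image_univ, hx])
    (by
      rw [Finset.card_image_of_injective _ hinj, Finset.card_image_of_injective _ hinj,
        Finset.card_add_card_compl, Fintype.card_fin, hn])
  rwa [Finset.card_image_of_injective _ hinj, Finset.card_compl, Fintype.card_fin,
    Finset.coe_image] at this

theorem isPrime_span_image (hn : ringKrullDim R = n)
    (hx : Ideal.span (Set.range x) = maximalIdeal R) (S : Finset (Fin n)) :
    (Ideal.span (x '' S)).IsPrime := by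
  have := (ringKrullDim_quotient_span_image hn hx S).1
  exact (Ideal.Quotient.isDomain_iff_prime _).mp (isDomain_of_isRegularLocalRing _)

theorem notMem_span_image (hn : ringKrullDim R = n)
    (hx : Ideal.span (Set.range x) = maximalIdeal R) {S : Finset (Fin n)} {i : Fin n}
    (hi : i ∉ S) : x i ∉ Ideal.span (x '' S) := by
  classical
  intro h
  have heq : Ideal.span (x '' (insert i S : Finset (Fin n))) = Ideal.span (x '' S) := by
    rw [Finset.coe_insert, Set.image_insert_eq]
    refine le_antisymm (Ideal.span_le.mpr ?_) (Ideal.span_mono (Set.subset_insert _ _))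
    exact Set.insert_subset h Ideal.subset_span
  have h1 := (ringKrullDim_quotient_span_image hn hx (insert i S)).2
  rw [heq, (ringKrullDim_quotient_span_image hn hx S).2, Finset.card_insert_of_notMem hi] at h1
  have h2 : n - S.card = n - (S.card + 1) := by exact_mod_cast h1
  have h3 : (insert i S).card ≤ n := by simpa using (insert i S).card_le_univ
  rw [Finset.card_insert_of_notMem hi] at h3
  omega

end SystemOfParameters

/-! ### Colon computations for powers of the parameters -/

section MonomialIdeals

variable {R : Type*} [CommRing R] {n : ℕ} (x : Fin n → R)

/-- The ideal generated by the powers `x_i ^ a_i`, `i ∈ S`. -/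
def monoIdeal (S : Finset (Fin n)) (a : Fin n → ℕ) : Ideal R :=
  Ideal.span ((fun i => x i ^ a i) '' S)

/-- The ideal `(x_1 ^ d, …, x_n ^ d)`. -/
def paramIdeal (d : ℕ) : Ideal R := monoIdeal x Finset.univ fun _ => d

variable {x}

theorem pow_mem_monoIdeal {S : Finset (Fin n)} {a : Fin n → ℕ} {i : Fin n} (hi : i ∈ S) {k : ℕ}
    (hk : a i ≤ k) : x i ^ k ∈ monoIdeal x S a :=
  Ideal.pow_mem_of_pow_mem _ (Ideal.subset_span ⟨i, hi, rfl⟩) hk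

theorem monoIdeal_le_iff {S : Finset (Fin n)} {a : Fin n → ℕ} {I : Ideal R} :
    monoIdeal x S a ≤ I ↔ ∀ i ∈ S, x i ^ a i ∈ I := by
  simp [monoIdeal, Ideal.span_le, Set.subset_def]

theorem monoIdeal_le {S T : Finset (Fin n)} {a b : Fin n → ℕ} (hST : S ⊆ T)
    (h : ∀ i ∈ S, b i ≤ a i) : monoIdeal x S a ≤ monoIdeal x T b :=
  monoIdeal_le_iff.mpr fun i hi => pow_mem_monoIdeal (hST hi) (h i hi)

theorem mem_monoIdeal_insert {S : Finset (Fin n)} {a : Fin n → ℕ} {j : Fin n} {u : R} :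
    u ∈ monoIdeal x (insert j S) a ↔ ∃ t, u - x j ^ a j * t ∈ monoIdeal x S a := by
  rw [monoIdeal, Finset.coe_insert, Set.image_insert_eq, Ideal.mem_span_insert]
  constructor
  · rintro ⟨t, z, hz, rfl⟩
    exact ⟨t, by rwa [mul_comm t, add_sub_cancel_left]⟩
  · rintro ⟨t, ht⟩
    exact ⟨t, _, ht, by ring⟩

theorem prod_mul_mem_monoIdeal {S T : Finset (Fin n)} {a : Fin n → ℕ} {k : ℕ} {u : R}
    (hu : u ∈ monoIdeal x T a) :
    (∏ i ∈ S, x i ^ k) * u ∈ monoIdeal x T fun i => if i ∈ S then a i + k else a i := by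
  classical
  suffices h : monoIdeal x T a ≤
      Submodule.comap (LinearMap.mulLeft R (∏ i ∈ S, x i ^ k))
        (monoIdeal x T fun i => if i ∈ S then a i + k else a i) from h hu
  refine monoIdeal_le_iff.mpr fun i hi => ?_
  rw [Submodule.mem_comap, LinearMap.mulLeft_apply]
  by_cases hS : i ∈ S
  · rw [← Finset.prod_erase_mul S _ hS, mul_assoc, ← pow_add]
    exact Ideal.mul_mem_left _ _ (pow_mem_monoIdeal hi (by simp [hS, add_comm]))
  · exact Ideal.mul_mem_left _ _ (pow_mem_monoIdeal hi (by simp [hS]))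

section Regular

variable [IsLocalRing R] [IsNoetherianRing R]

/-- Induction on the sum of the exponents. If all are 1 the ideal is prime and misses `x i`; an
exponent m + 1 ≥ 2 is split into the smaller exponents m and 1. -/
theorem mem_monoIdeal_of_mul_mem (hn : ringKrullDim R = n)
    (hx : Ideal.span (Set.range x) = maximalIdeal R) (N : ℕ) :
    ∀ (S : Finset (Fin n)) (a : Fin n → ℕ), ∑ j ∈ S, a j ≤ N → ∀ i ∉ S, ∀ u : R,
      x i * u ∈ monoIdeal x S a → u ∈ monoIdeal x S a := by
  classical
  induction N with
  | zero =>
    intro S a hN i hi u hu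
    rcases S.eq_empty_or_nonempty with rfl | ⟨j, hj⟩
    · have := isPrime_span_image hn hx ∅
      have h0 : monoIdeal x ∅ a = Ideal.span (x '' (∅ : Finset (Fin n))) := by simp [monoIdeal]
      rw [h0] at hu ⊢
      exact (this.mem_or_mem hu).resolve_left (notMem_span_image hn hx hi)
    · have h0 : a j = 0 := by
        have := Finset.single_le_sum (f := a) (fun _ _ => Nat.zero_le _) hj
        omega
      have h1 : (1 : R) ∈ monoIdeal x S a := by
        simpa using pow_mem_monoIdeal (x := x) hj h0.le
      exact (Ideal.eq_top_iff_one _).mpr h1 ▸ Submodule.mem_top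
  | succ N ih =>
    intro S a hN i hi u hu
    by_cases h0 : ∃ j ∈ S, a j = 0
    · obtain ⟨j, hj, h0⟩ := h0
      have h1 : (1 : R) ∈ monoIdeal x S a := by
        simpa using pow_mem_monoIdeal (x := x) hj h0.le
      exact (Ideal.eq_top_iff_one _).mpr h1 ▸ Submodule.mem_top
    push Not at h0
    by_cases h2 : ∃ j ∈ S, 2 ≤ a j
    · obtain ⟨j, hj, h2⟩ := h2
      obtain ⟨T, hjT, rfl⟩ : ∃ T, j ∉ T ∧ insert j T = S :=
        ⟨S.erase j, Finset.notMem_erase j S, Finset.insert_erase hj⟩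
      have hiT : i ∉ T := fun h => hi (Finset.mem_insert_of_mem h)
      have hupd : ∀ c, monoIdeal x T (Function.update a j c) = monoIdeal x T a := by
        intro c
        refine le_antisymm (monoIdeal_le subset_rfl fun l hl => ?_)
          (monoIdeal_le subset_rfl fun l hl => ?_) <;>
        · rw [Function.update_of_ne (ne_of_mem_of_not_mem hl hjT)]
      have hsum : ∀ c, ∑ l ∈ T, Function.update a j c l = ∑ l ∈ T, a l := fun c =>
        Finset.sum_congr rfl fun l hl => Function.update_of_ne (ne_of_mem_of_not_mem hl hjT) _ _
      rw [Finset.sum_insert hjT] at hN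
      have hmem : ∀ c v, v ∈ monoIdeal x (insert j T) (Function.update a j c) ↔
          ∃ t, v - x j ^ c * t ∈ monoIdeal x T a := by
        intro c v
        rw [mem_monoIdeal_insert, Function.update_self, hupd]
      have step : ∀ c < a j, ∀ v, x i * v ∈ monoIdeal x (insert j T) (Function.update a j c) →
          v ∈ monoIdeal x (insert j T) (Function.update a j c) := fun c hc v hv =>
        ih _ _ (by rw [Finset.sum_insert hjT, Function.update_self, hsum]; omega) i hi v hv
      have hpow : ∀ (c : ℕ) (v : R), x j ^ c * v ∈ monoIdeal x T a → v ∈ monoIdeal x T a := by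
        intro c
        induction c with
        | zero => intro v hv; simpa using hv
        | succ c ihc =>
          intro v hv
          rw [pow_succ, mul_assoc] at hv
          exact ih T a (by omega) j hjT v (ihc _ hv)
      obtain ⟨m, hm⟩ : ∃ m, a j = m + 1 := ⟨a j - 1, by omega⟩
      obtain ⟨s, hs⟩ := mem_monoIdeal_insert.mp hu
      rw [hm] at hs
      obtain ⟨t, ht⟩ := (hmem m u).mp (step m (by omega) u ((hmem m _).mpr ⟨x j * s, by
        rwa [← mul_assoc, ← pow_succ]⟩))
      -- With u ≡ x_j^m t, cancelling x_j^m modulo the ideal without x_j shows x_i t ≡ x_j s, so the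
      -- case of exponent 1 applies to t.
      have h3 : x i * t - x j * s ∈ monoIdeal x T a := by
        refine hpow m _ ?_
        have : x j ^ m * (x i * t - x j * s) =
            (x i * u - x j ^ (m + 1) * s) - x i * (u - x j ^ m * t) := by ring
        rw [this]
        exact Ideal.sub_mem _ hs (Ideal.mul_mem_left _ _ ht)
      obtain ⟨s', hs'⟩ := (hmem 1 t).mp (step 1 (by omega) t ((hmem 1 _).mpr ⟨s, by
        rwa [pow_one]⟩))
      refine mem_monoIdeal_insert.mpr ⟨s', ?_⟩
      have : u - x j ^ a j * s' = (u - x j ^ m * t) + x j ^ m * (t - x j ^ 1 * s') := by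
        rw [hm]; ring
      rw [this]
      exact Ideal.add_mem _ ht (Ideal.mul_mem_left _ _ hs')
    · push Not at h2
      have h1 : monoIdeal x S a = Ideal.span (x '' S) := by
        rw [monoIdeal]
        congr 1
        refine Set.image_congr fun j hj => ?_
        have := h0 j hj
        have := h2 j hj
        rw [show a j = 1 by omega, pow_one]
      have := isPrime_span_image hn hx S
      rw [h1] at hu ⊢
      exact (this.mem_or_mem hu).resolve_left (notMem_span_image hn hx hi)

theorem mem_monoIdeal_of_pow_mul_mem (hn : ringKrullDim R = n)
    (hx : Ideal.span (Set.range x) = maximalIdeal R) {S : Finset (Fin n)} {a : Fin n → ℕ}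
    {i : Fin n} (hi : i ∉ S) (k : ℕ) {u : R} (hu : x i ^ k * u ∈ monoIdeal x S a) :
    u ∈ monoIdeal x S a := by
  induction k generalizing u with
  | zero => simpa using hu
  | succ k ih =>
    rw [pow_succ, mul_assoc] at hu
    exact mem_monoIdeal_of_mul_mem hn hx _ S a le_rfl i hi u (ih hu)

theorem exists_sub_mem_monoIdeal_erase (hn : ringKrullDim R = n)
    (hx : Ideal.span (Set.range x) = maximalIdeal R) {a : Fin n → ℕ} {i : Fin n} {k c : ℕ}
    (ha : a i = k + c) {u : R} (hu : x i ^ k * u ∈ monoIdeal x Finset.univ a) :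
    ∃ t, u - x i ^ c * t ∈ monoIdeal x (Finset.univ.erase i) a := by
  rw [← Finset.insert_erase (Finset.mem_univ i), mem_monoIdeal_insert] at hu
  obtain ⟨t, ht⟩ := hu
  refine ⟨t, mem_monoIdeal_of_pow_mul_mem hn hx (Finset.notMem_erase i _) k ?_⟩
  rwa [mul_sub, ← mul_assoc, ← pow_add, ← ha]

theorem mem_monoIdeal_of_prod_mul_mem (hn : ringKrullDim R = n)
    (hx : Ideal.span (Set.range x) = maximalIdeal R) (S : Finset (Fin n)) {k : ℕ}
    {a : Fin n → ℕ} {u : R}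
    (hu : (∏ i ∈ S, x i ^ k) * u ∈ monoIdeal x Finset.univ fun i =>
      if i ∈ S then a i + k else a i) :
    u ∈ monoIdeal x Finset.univ a := by
  classical
  induction S using Finset.induction_on generalizing u with
  | empty => simpa using hu
  | insert j S hj ih =>
    rw [Finset.prod_insert hj, mul_assoc] at hu
    obtain ⟨t, ht⟩ := exists_sub_mem_monoIdeal_erase hn hx (i := j) (k := k) (c := a j)
      (by simp [add_comm]) hu
    refine ih ?_
    rw [← Finset.insert_erase (Finset.mem_univ j), mem_monoIdeal_insert]
    refine ⟨t, ?_⟩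
    rw [if_neg hj]
    refine monoIdeal_le subset_rfl (fun i hi => ?_) ht
    have : i ≠ j := Finset.ne_of_mem_erase hi
    simp [this]

theorem mem_paramIdeal_of_prod_pow_mul_mem (hn : ringKrullDim R = n)
    (hx : Ideal.span (Set.range x) = maximalIdeal R) {d k : ℕ} {u : R}
    (hu : (∏ i, x i) ^ k * u ∈ paramIdeal x (d + k)) : u ∈ paramIdeal x d := by
  refine mem_monoIdeal_of_prod_mul_mem hn hx Finset.univ (k := k) ?_
  simpa [Finset.prod_pow, paramIdeal] using hu

/-- The variables are treated one at a time: after the factor x_j^k has been extracted for j ∈ S,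
the cofactor matters only modulo exponent d on S and d + k elsewhere, and being killed there by
x_i^d forces divisibility by x_i^k. -/
theorem exists_sub_prod_pow_mul_mem_paramIdeal (hn : ringKrullDim R = n)
    (hx : Ideal.span (Set.range x) = maximalIdeal R) {d k : ℕ} {u : R}
    (hu : ∀ i, x i ^ d * u ∈ paramIdeal x (d + k)) :
    ∃ t, u - (∏ i, x i) ^ k * t ∈ paramIdeal x (d + k) := by
  classical
  suffices h : ∀ S : Finset (Fin n), ∃ t, u - (∏ i ∈ S, x i ^ k) * t ∈ paramIdeal x (d + k) by
    simpa [← Finset.prod_pow] using h Finset.univ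
  intro S
  induction S using Finset.induction_on with
  | empty => exact ⟨u, by simp⟩
  | insert i S hi ih =>
    obtain ⟨t, ht⟩ := ih
    have hite : (fun j => if j ∈ S then (if j ∈ S then d else d + k) + k
        else (if j ∈ S then d else d + k)) = fun _ => d + k := by
      ext j; split_ifs <;> rfl
    have h1 : x i ^ d * t ∈ monoIdeal x Finset.univ fun j => if j ∈ S then d else d + k := by
      refine mem_monoIdeal_of_prod_mul_mem hn hx S (k := k) ?_
      rw [hite]
      have : (∏ j ∈ S, x j ^ k) * (x i ^ d * t) =
          x i ^ d * u - x i ^ d * (u - (∏ j ∈ S, x j ^ k) * t) := by ring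
      rw [this]
      exact Ideal.sub_mem _ (hu i) (Ideal.mul_mem_left _ _ ht)
    obtain ⟨t', ht'⟩ := exists_sub_mem_monoIdeal_erase hn hx (i := i) (k := d) (c := k)
      (by simp [hi]) h1
    refine ⟨t', ?_⟩
    have h2 := prod_mul_mem_monoIdeal (S := S) (k := k) ht'
    rw [hite] at h2
    have : u - (∏ j ∈ insert i S, x j ^ k) * t' = (u - (∏ j ∈ S, x j ^ k) * t) +
        (∏ j ∈ S, x j ^ k) * (t - x i ^ k * t') := by
      rw [Finset.prod_insert hi]; ring
    rw [this]
    exact Ideal.add_mem _ ht (monoIdeal_le (Finset.subset_univ _) (fun _ _ => le_rfl) h2)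

theorem exists_pow_le_paramIdeal (hx : Ideal.span (Set.range x) = maximalIdeal R) (d : ℕ) :
    ∃ N, maximalIdeal R ^ N ≤ paramIdeal x d := by
  refine Ideal.exists_pow_le_of_le_radical_of_fg ?_ (IsNoetherian.noetherian _)
  rw [← hx, Ideal.span_le]
  rintro _ ⟨i, rfl⟩
  exact ⟨d, pow_mem_monoIdeal (Finset.mem_univ i) le_rfl⟩

end Regular

theorem paramIdeal_one [IsLocalRing R]
    (hx : Ideal.span (Set.range x) = maximalIdeal R) :
    paramIdeal x 1 = maximalIdeal R := by
  simp [paramIdeal, monoIdeal, ← hx]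

theorem paramIdeal_le_pow [IsLocalRing R]
    (hx : Ideal.span (Set.range x) = maximalIdeal R) (d : ℕ) :
    paramIdeal x d ≤ maximalIdeal R ^ d :=
  monoIdeal_le_iff.mpr fun i _ =>
    Ideal.pow_mem_pow (hx ▸ Ideal.subset_span (Set.mem_range_self i)) d

theorem paramIdeal_anti {d d' : ℕ} (h : d ≤ d') : paramIdeal x d' ≤ paramIdeal x d :=
  monoIdeal_le subset_rfl fun _ _ => h

theorem frobPower_eq_map (p : ℕ) [Fact p.Prime] [CharP R p] (I : Ideal R) (e : ℕ) :
    frobPower I (p ^ e) = I.map (iterateFrobenius R p e) := rfl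

theorem frobPower_paramIdeal (p : ℕ) [Fact p.Prime] [CharP R p] (d e : ℕ) :
    frobPower (paramIdeal x d) (p ^ e) = paramIdeal x (d * p ^ e) := by
  rw [frobPower_eq_map, paramIdeal, paramIdeal, monoIdeal, monoIdeal, Ideal.map_span]
  congr 1
  rw [Set.image_image]
  refine Set.image_congr fun i _ => ?_
  rw [iterateFrobenius_def, pow_mul]

theorem pow_mem_frobPower {I : Ideal R} {y : R} (hy : y ∈ I) (q : ℕ) : y ^ q ∈ frobPower I q :=
  Ideal.subset_span ⟨y, hy, rfl⟩

end MonomialIdeals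

/-! ### Generators of the top local cohomology module -/

section Generators

variable {R : Type*} [CommRing R] {n : ℕ} (x : Fin n → R)

/-- The class of `1 / (x_1 ⋯ x_n) ^ d` in the top cohomology module. -/
def gen (d : ℕ) : TopCoh x :=
  (locBoundary x).mkQ (IsLocalization.Away.invSelf (∏ i, x i) ^ d)

variable {x}

theorem smul_gen (u : R) (d : ℕ) : u • gen x d = (locBoundary x).mkQ
    (algebraMap R (LocProd x) u * IsLocalization.Away.invSelf (∏ i, x i) ^ d) := by
  rw [gen, ← map_smul, Algebra.smul_def]

theorem map_prod_pow_mul_invSelf_pow (d : ℕ) :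
    algebraMap R (LocProd x) ((∏ i, x i) ^ d) * IsLocalization.Away.invSelf (∏ i, x i) ^ d = 1 := by
  rw [map_pow, ← mul_pow, IsLocalization.Away.mul_invSelf, one_pow]

theorem prod_pow_smul_gen (d k : ℕ) : (∏ i, x i) ^ k • gen x (d + k) = gen x d := by
  rw [smul_gen, gen, pow_add, mul_left_comm, map_prod_pow_mul_invSelf_pow, mul_one]

theorem exists_eq_smul_gen (w : TopCoh x) : ∃ (d : ℕ) (u : R), w = u • gen x d := by
  obtain ⟨z, rfl⟩ := (locBoundary x).mkQ_surjective w
  obtain ⟨d, u, h⟩ := IsLocalization.Away.surj (∏ i, x i) z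
  refine ⟨d, u, ?_⟩
  rw [smul_gen, ← h, mul_assoc, ← map_pow, map_prod_pow_mul_invSelf_pow, mul_one]

theorem exists_eq_smul_gen_of_le {d D : ℕ} (h : d ≤ D) (u : R) :
    u • gen x d = ((∏ i, x i) ^ (D - d) * u) • gen x D := by
  obtain ⟨k, rfl⟩ := Nat.exists_eq_add_of_le h
  rw [Nat.add_sub_cancel_left, mul_comm, mul_smul, prod_pow_smul_gen]

theorem smul_gen_eq_zero_of_mem {d : ℕ} {u : R} (hu : u ∈ paramIdeal x d) : u • gen x d = 0 := by
  rw [← Ideal.mem_torsionOf_iff]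
  refine monoIdeal_le_iff.mpr (fun i _ => ?_) hu
  rw [Ideal.mem_torsionOf_iff, smul_gen, Submodule.mkQ_apply, Submodule.Quotient.mk_eq_zero]
  refine le_iSup (locImage x) i ⟨1, d, ?_⟩
  rw [← mul_assoc, ← map_mul, ← mul_pow, Finset.prod_erase_mul _ _ (Finset.mem_univ i),
    map_prod_pow_mul_invSelf_pow, map_one]

theorem smul_eq_zero_of_mem_paramIdeal {d : ℕ} {a u : R} (ha : a ∈ paramIdeal x d) :
    a • u • gen x d = 0 := by
  rw [smul_comm, smul_gen_eq_zero_of_mem ha, smul_zero]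

/-- Asking for every large D, not just one, lets the summands of a boundary share an exponent. -/
theorem exists_mem_paramIdeal_of_mem_locBoundary {s : LocProd x} (hs : s ∈ locBoundary x) :
    ∃ D₀, ∀ D ≥ D₀, ∃ a ∈ paramIdeal x D,
      algebraMap R (LocProd x) ((∏ i, x i) ^ D) * s = algebraMap R (LocProd x) a := by
  classical
  refine Submodule.iSup_induction (locImage x)
    (motive := fun s => ∃ D₀, ∀ D ≥ D₀, ∃ a ∈ paramIdeal x D,
      algebraMap R (LocProd x) ((∏ i, x i) ^ D) * s = algebraMap R (LocProd x) a) hs ?_ ?_ ?_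
  · rintro i s ⟨a, d, h⟩
    refine ⟨d, fun D hD => ?_⟩
    obtain ⟨k, rfl⟩ := Nat.exists_eq_add_of_le hD
    refine ⟨(∏ j ∈ Finset.univ.erase i, x j) ^ k * a * x i ^ (d + k),
      Ideal.mul_mem_left _ _ (pow_mem_monoIdeal (Finset.mem_univ i) le_rfl), ?_⟩
    have h0 : (∏ j, x j) ^ (d + k) = (∏ j ∈ Finset.univ.erase i, x j) ^ d *
        ((∏ j ∈ Finset.univ.erase i, x j) ^ k * x i ^ (d + k)) := by
      rw [← mul_assoc, ← pow_add, ← mul_pow, Finset.prod_erase_mul _ _ (Finset.mem_univ i)]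
    rw [h0, map_mul, map_mul, map_mul, map_mul, ← h]
    ring
  · exact ⟨0, fun D _ => ⟨0, Ideal.zero_mem _, by simp⟩⟩
  · rintro s t ⟨D₁, h₁⟩ ⟨D₂, h₂⟩
    refine ⟨max D₁ D₂, fun D hD => ?_⟩
    obtain ⟨a, ha, hs⟩ := h₁ D (le_of_max_le_left hD)
    obtain ⟨b, hb, ht⟩ := h₂ D (le_of_max_le_right hD)
    exact ⟨a + b, Ideal.add_mem _ ha hb, by rw [mul_add, hs, ht, map_add]⟩

theorem frobE_iterate_gen (p : ℕ) [Fact p.Prime] [CharP R p] (d e : ℕ) :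
    (frobE p x)^[e] (gen x d) = gen x (d * p ^ e) := by
  induction e generalizing d with
  | zero => simp
  | succ e ih =>
    have h : frobE p x (gen x d) = gen x (d * p) := by
      rw [gen, gen, pow_mul]
      rfl
    rw [Function.iterate_succ_apply, h, ih, mul_assoc, pow_succ']

theorem frobE_iterate_smul_gen (p : ℕ) [Fact p.Prime] [CharP R p] (u : R) (d e : ℕ) :
    (frobE p x)^[e] (u • gen x d) = u ^ p ^ e • gen x (d * p ^ e) := by
  rw [frobE_iterate_smul, frobE_iterate_gen]

end Generators

/-! ### Elements killed by powers of the parameters, and the socle -/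

section Annihilators

variable {R : Type*} [CommRing R] [IsRegularLocalRing R] {n : ℕ} {x : Fin n → R}

/-- Clearing denominators in the boundary puts u (x_1⋯x_n)^{D₀} in (x_i^{d+D₀}); `R` embeds in the
localization as a domain, and the monomial factor cancels. -/
theorem smul_gen_eq_zero_iff (hn : ringKrullDim R = n)
    (hx : Ideal.span (Set.range x) = maximalIdeal R) {d : ℕ} {u : R} :
    u • gen x d = 0 ↔ u ∈ paramIdeal x d := by
  refine ⟨fun h => ?_, smul_gen_eq_zero_of_mem⟩
  have := isDomain_of_isRegularLocalRing R
  have hx0 : ∏ i, x i ≠ 0 := by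
    refine Finset.prod_ne_zero_iff.mpr fun i _ h0 => ?_
    refine notMem_span_image hn hx (Finset.notMem_empty i) ?_
    rw [h0]
    exact Ideal.zero_mem _
  rw [smul_gen, Submodule.mkQ_apply, Submodule.Quotient.mk_eq_zero] at h
  obtain ⟨D₀, hD⟩ := exists_mem_paramIdeal_of_mem_locBoundary h
  obtain ⟨a, ha, h1⟩ := hD (d + D₀) (Nat.le_add_left _ _)
  rw [add_comm d D₀, pow_add, mul_left_comm, map_mul, mul_assoc, map_prod_pow_mul_invSelf_pow,
    mul_one, ← map_mul] at h1
  have hinj : Function.Injective (algebraMap R (LocProd x)) :=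
    IsLocalization.injective _ (powers_le_nonZeroDivisors_of_noZeroDivisors hx0)
  refine mem_paramIdeal_of_prod_pow_mul_mem hn hx (k := D₀) ?_
  rw [mul_comm, hinj h1]
  exact ha

theorem eq_smul_gen_of_forall_mem_paramIdeal (hn : ringKrullDim R = n)
    (hx : Ideal.span (Set.range x) = maximalIdeal R) {d : ℕ} {w : TopCoh x}
    (hw : ∀ a ∈ paramIdeal x d, a • w = 0) : ∃ t : R, w = t • gen x d := by
  obtain ⟨D, u, rfl⟩ := exists_eq_smul_gen w
  rw [exists_eq_smul_gen_of_le (Nat.le_add_left D d)] at hw ⊢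
  set v := (∏ i, x i) ^ (d + D - D) * u
  obtain ⟨t, ht⟩ := exists_sub_prod_pow_mul_mem_paramIdeal hn hx (d := d) (k := D) (u := v)
    fun i => by
      rw [← smul_gen_eq_zero_iff hn hx, mul_smul]
      exact hw _ (pow_mem_monoIdeal (Finset.mem_univ i) le_rfl)
  refine ⟨t, ?_⟩
  rw [← smul_gen_eq_zero_iff hn hx, sub_smul, sub_eq_zero] at ht
  rw [ht, mul_comm, mul_smul, prod_pow_smul_gen]

theorem exists_pow_smul_eq_zero (hx : Ideal.span (Set.range x) = maximalIdeal R) (w : TopCoh x) :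
    ∃ N, ∀ a ∈ maximalIdeal R ^ N, a • w = 0 := by
  obtain ⟨d, u, rfl⟩ := exists_eq_smul_gen w
  obtain ⟨N, hN⟩ := exists_pow_le_paramIdeal hx d
  exact ⟨N, fun a ha => smul_eq_zero_of_mem_paramIdeal (hN ha)⟩

theorem eq_smul_gen_one_of_forall_mem_maximalIdeal (hn : ringKrullDim R = n)
    (hx : Ideal.span (Set.range x) = maximalIdeal R) {w : TopCoh x}
    (hw : ∀ a ∈ maximalIdeal R, a • w = 0) : ∃ t : R, w = t • gen x 1 :=
  eq_smul_gen_of_forall_mem_paramIdeal hn hx (by rwa [paramIdeal_one hx])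

end Annihilators

/-- A nonzero element killed by a power of an ideal has a nonzero multiple killed by the ideal. -/
theorem exists_smul_ne_zero_of_pow_smul_eq_zero {R V : Type*} [CommRing R] [AddCommGroup V]
    [Module R V] {I : Ideal R} {v : V} (hv : v ≠ 0) {N : ℕ} (hN : ∀ a ∈ I ^ N, a • v = 0) :
    ∃ c : R, c • v ≠ 0 ∧ ∀ a ∈ I, a • c • v = 0 := by
  induction N with
  | zero => exact absurd (by simpa using hN 1) hv
  | succ N ih =>
    by_cases h : ∀ a ∈ I ^ N, a • v = 0
    · exact ih h
    · push Not at h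
      obtain ⟨c, hc, hcv⟩ := h
      refine ⟨c, hcv, fun a ha => ?_⟩
      rw [smul_smul]
      exact hN _ (by rw [pow_succ']; exact Ideal.mul_mem_mul ha hc)

section Socle

variable {R : Type*} [CommRing R] [IsRegularLocalRing R] {n : ℕ} {x : Fin n → R}

/-- Every element is 𝔪-power torsion, so a nonzero one has a nonzero multiple in the socle, which
consists of the multiples of `gen x 1`. Thus `E` is an essential extension of a simple socle. -/
theorem exists_smul_eq_gen_one (hn : ringKrullDim R = n)
    (hx : Ideal.span (Set.range x) = maximalIdeal R) {w : TopCoh x} (hw : w ≠ 0) :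
    ∃ c : R, c • w = gen x 1 := by
  obtain ⟨N, hN⟩ := exists_pow_smul_eq_zero hx w
  obtain ⟨c, hc0, hc⟩ := exists_smul_ne_zero_of_pow_smul_eq_zero hw hN
  obtain ⟨t, ht⟩ := eq_smul_gen_one_of_forall_mem_maximalIdeal hn hx hc
  have htu : IsUnit t := by
    by_contra h
    rw [← mem_nonunits_iff, ← mem_maximalIdeal, ← paramIdeal_one hx] at h
    exact hc0 (ht.trans (smul_gen_eq_zero_of_mem h))
  obtain ⟨t', ht'⟩ := htu.exists_left_inv
  exact ⟨t' * c, by rw [mul_smul, ht, smul_smul, ht', one_smul]⟩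

theorem gen_ne_zero (hn : ringKrullDim R = n)
    (hx : Ideal.span (Set.range x) = maximalIdeal R) {d : ℕ} (hd : 0 < d) : gen x d ≠ 0 := by
  intro h
  have h1 : (1 : R) ∈ paramIdeal x d := by rw [← smul_gen_eq_zero_iff hn hx, one_smul, h]
  have h2 := paramIdeal_anti (x := x) hd h1
  rw [paramIdeal_one hx] at h2
  exact (maximalIdeal.isMaximal R).ne_top ((Ideal.eq_top_iff_one _).mpr h2)

/-- By essentiality it is enough to look at `gen x 1`, which is sent to `gen x (p ^ e)` ≠ 0. -/
theorem frobE_iterate_eq_zero_iff (p : ℕ) [Fact p.Prime] [CharP R p] (hn : ringKrullDim R = n)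
    (hx : Ideal.span (Set.range x) = maximalIdeal R) {e : ℕ} {w : TopCoh x} :
    (frobE p x)^[e] w = 0 ↔ w = 0 := by
  refine ⟨fun h => ?_, fun h => by rw [h, frobE_iterate_zero]⟩
  by_contra hw
  obtain ⟨c, hc⟩ := exists_smul_eq_gen_one hn hx hw
  have h1 := congrArg (frobE p x)^[e] hc
  rw [frobE_iterate_smul, h, smul_zero, frobE_iterate_gen, one_mul] at h1
  exact gen_ne_zero hn hx (pow_pos (Fact.out : p.Prime).pos e) h1.symm

end Socle

/-! ### `E` is Artinian -/

section Artinian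

/-- If `x` acts locally nilpotently on `V` and its kernel is Artinian, then `V` is Artinian. -/
theorem isArtinian_of_ker_smul {R V : Type*} [CommRing R] [AddCommGroup V] [Module R V] (x : R)
    (hx : ∀ v : V, ∃ k, x ^ k • v = 0)
    [IsArtinian R (LinearMap.ker (LinearMap.lsmul R V x))] : IsArtinian R V := by
  let K := LinearMap.ker (LinearMap.lsmul R V x)
  -- L_k(N) = x^k N ∩ ker x, the analogue of leading coefficients in Hilbert's basis theorem:
  -- monotone in N, antitone in k.
  let L : ℕ → Submodule R V → Submodule R K := fun k N =>
    (N.map (LinearMap.lsmul R V (x ^ k))).comap K.subtype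
  have hLN : ∀ k, Monotone (L k) := fun k N N' h => Submodule.comap_mono (Submodule.map_mono h)
  have hLk : ∀ N, Antitone fun k => L k N := by
    intro N
    refine antitone_nat_of_succ_le fun k => Submodule.comap_mono ?_
    rintro _ ⟨v, hv, rfl⟩
    refine ⟨x • v, N.smul_mem x hv, ?_⟩
    simp [smul_smul, pow_succ, mul_comm]
  refine (monotone_stabilizes_iff_artinian).mp fun f => ?_
  let F : ℕ → Submodule R V := fun j => OrderDual.ofDual (f j)
  have hf : Antitone F := fun i j h => f.monotone h
  -- The diagonal L_k(F_k) stabilizes at some k₀, which settles all k ≥ k₀ at once; the finitely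
  -- many k < k₀ stabilize separately.
  let g : ℕ →o (Submodule R K)ᵒᵈ :=
    ⟨fun k => OrderDual.toDual (L k (F k)), fun i j h =>
      (hLN _ (hf h)).trans (hLk _ h)⟩
  obtain ⟨k₀, hk₀⟩ := IsArtinian.monotone_stabilizes g
  have hcol : ∀ k, ∃ j₀, ∀ j ≥ j₀,
      L k (F j₀) = L k (F j) := by
    intro k
    obtain ⟨j₀, h⟩ := IsArtinian.monotone_stabilizes
      (⟨fun j => OrderDual.toDual (L k (F j)),
        fun i j h => hLN _ (hf h)⟩ : ℕ →o (Submodule R K)ᵒᵈ)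
    exact ⟨j₀, fun j hj => h j hj⟩
  choose j₀ hj₀ using hcol
  let j₁ := max k₀ ((Finset.range k₀).sup j₀)
  have hmain : ∀ k, ∀ j ≥ j₁, L k (F j₁) ≤ L k (F j) := by
    intro k j hj
    rcases lt_or_ge k k₀ with hk | hk
    · have h1 : j₀ k ≤ j₁ :=
        (Finset.le_sup (f := j₀) (Finset.mem_range.mpr hk)).trans (le_max_right _ _)
      rw [← hj₀ k j (h1.trans hj)]
      exact hLN k (hf h1)
    · have h1 : L k₀ (F k₀) =
          L (max j k) (F (max j k)) := hk₀ _ (hk.trans (le_max_right _ _))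
      calc L k (F j₁) ≤ L k₀ (F k₀) :=
            (hLN k (hf (le_max_left _ _))).trans (hLk _ hk)
        _ = L (max j k) (F (max j k)) := h1
        _ ≤ L k (F j) :=
            (hLN _ (hf (le_max_left _ _))).trans (hLk _ (le_max_right _ _))
  refine ⟨j₁, fun j hj => ?_⟩
  suffices h : ∀ k, ∀ w ∈ F j₁, x ^ k • w = 0 → w ∈ F j from
    le_antisymm (α := Submodule R V) (fun w hw => let ⟨k, hk⟩ := hx w; h k w hw hk) (hf hj)
  -- Induction on the power of x killing w: some w' in the smaller submodule has x^k w' = x^k w, and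
  -- w - w' is killed by x^k.
  intro k
  induction k with
  | zero => intro w _ h; rw [pow_zero, one_smul] at h; rw [h]; exact zero_mem _
  | succ k ih =>
    intro w hw h
    have hK : x ^ k • w ∈ K := by
      rw [LinearMap.mem_ker, LinearMap.lsmul_apply, smul_smul, ← pow_succ', h]
    obtain ⟨w', hw', h'⟩ := hmain k j hj (show (⟨x ^ k • w, hK⟩ : K) ∈ L k _ from ⟨w, hw, rfl⟩)
    have h'' : x ^ k • w' = x ^ k • w := h'
    have := ih (w - w') (sub_mem hw (hf hj hw')) (by rw [smul_sub, h'', sub_self])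
    simpa using add_mem this hw'

theorem isArtinian_ker_lsmul_of_le {R V : Type*} [CommRing R] [AddCommGroup V]
    [Module R V] (x : R) {W W' : Submodule R V} [IsArtinian R W']
    (h : ∀ v : W, x • v = 0 → (v : V) ∈ W') :
    IsArtinian R (LinearMap.ker (LinearMap.lsmul R W x)) := by
  let g : LinearMap.ker (LinearMap.lsmul R W x) →ₗ[R] W' :=
    (W.subtype ∘ₗ (LinearMap.ker (LinearMap.lsmul R W x)).subtype).codRestrict W'
      fun v => h v.1 (LinearMap.mem_ker.mp v.2)
  refine isArtinian_of_injective g ?_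
  have hg : W'.subtype ∘ₗ g = W.subtype ∘ₗ (LinearMap.ker (LinearMap.lsmul R W x)).subtype :=
    LinearMap.subtype_comp_codRestrict _ _ _
  have hinj : Function.Injective (W'.subtype ∘ₗ g) := by
    rw [hg, LinearMap.coe_comp]
    exact (Submodule.injective_subtype _).comp (Submodule.injective_subtype _)
  exact Function.Injective.of_comp (by rwa [LinearMap.coe_comp] at hinj)

/-- Starting from the common kernel of all the x_i, the conditions x_i w = 0 are dropped one at a
time, each by `isArtinian_of_ker_smul`. -/
theorem isArtinian_of_forall_pow_smul_eq_zero {R V : Type*} [CommRing R] [AddCommGroup V]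
    [Module R V] {n : ℕ} (x : Fin n → R) (hx : ∀ i, ∀ v : V, ∃ k, x i ^ k • v = 0)
    {K : Submodule R V} [IsArtinian R K] (hK : ∀ v : V, (∀ i, x i • v = 0) → v ∈ K) :
    IsArtinian R V := by
  classical
  let A : Finset (Fin n) → Submodule R V := fun S =>
    ⨅ i ∈ S, LinearMap.ker (LinearMap.lsmul R V (x i))
  have hmem : ∀ S w, w ∈ A S ↔ ∀ i ∈ S, x i • w = 0 := by
    intro S w
    simp [A]
  suffices h : ∀ S, IsArtinian R (A Sᶜ) by
    have h1 := h Finset.univ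
    have h2 : A Finset.univᶜ = ⊤ := by simp [A]
    rw [h2] at h1
    exact isArtinian_of_linearEquiv Submodule.topEquiv
  intro S
  induction S using Finset.induction_on with
  | empty =>
    have h1 : A ∅ᶜ ≤ K := fun w hw => hK w fun i => (hmem _ _).mp hw i (by simp)
    exact isArtinian_of_le h1
  | insert i S hi ih =>
    have hker : ∀ v : A (insert i S)ᶜ, x i • v = 0 → (v : V) ∈ A Sᶜ := by
      intro v hv
      rw [hmem]
      intro j hj
      by_cases hji : j = i
      · rw [hji, ← Submodule.coe_smul, hv, Submodule.coe_zero]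
      · exact (hmem _ _).mp v.2 j (by simpa [hji] using hj)
    have := isArtinian_ker_lsmul_of_le (x i) hker
    refine isArtinian_of_ker_smul (x i) fun v => ?_
    obtain ⟨N, hN⟩ := hx i (v : V)
    exact ⟨N, Subtype.ext ((Submodule.coe_smul _ _).trans hN)⟩

theorem isArtinian_span_singleton_of_maximalIdeal_smul {R V : Type*} [CommRing R] [IsLocalRing R]
    [AddCommGroup V] [Module R V] {v : V} (hv : ∀ a ∈ maximalIdeal R, a • v = 0) :
    IsArtinian R (LinearMap.range (LinearMap.toSpanSingleton R V v)) := by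
  have hart : IsArtinian R (R ⧸ maximalIdeal R) := by
    have : IsSimpleModule R (R ⧸ maximalIdeal R) :=
      isSimpleModule_iff_isCoatom.mpr (maximalIdeal.isMaximal R).out
    infer_instance
  refine isArtinian_of_surjective (M := R ⧸ maximalIdeal R)
    ((Submodule.liftQ (maximalIdeal R) (LinearMap.toSpanSingleton R V v) hv).codRestrict
      (LinearMap.range (LinearMap.toSpanSingleton R V v)) ?_) ?_
  · intro c
    obtain ⟨a, rfl⟩ := Submodule.mkQ_surjective _ c
    exact ⟨a, rfl⟩
  · rintro ⟨_, a, rfl⟩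
    exact ⟨Submodule.Quotient.mk a, rfl⟩

variable {R : Type*} [CommRing R] [IsRegularLocalRing R] {n : ℕ} {x : Fin n → R}

theorem isArtinian_topCoh (hn : ringKrullDim R = n)
    (hx : Ideal.span (Set.range x) = maximalIdeal R) : IsArtinian R (TopCoh x) := by
  have := isArtinian_span_singleton_of_maximalIdeal_smul (v := gen x 1) fun a ha => by
    rw [← paramIdeal_one hx] at ha
    exact smul_gen_eq_zero_of_mem ha
  refine isArtinian_of_forall_pow_smul_eq_zero x (fun i w => ?_)
    (K := LinearMap.range (LinearMap.toSpanSingleton R (TopCoh x) (gen x 1))) fun w hw => ?_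
  · obtain ⟨N, hN⟩ := exists_pow_smul_eq_zero hx w
    exact ⟨N, hN _ (Ideal.pow_mem_pow (hx ▸ Ideal.subset_span ⟨i, rfl⟩) N)⟩
  · obtain ⟨t, rfl⟩ := eq_smul_gen_one_of_forall_mem_maximalIdeal hn hx (w := w) (fun a ha => by
      rw [← Ideal.mem_torsionOf_iff]
      refine (hx ▸ Ideal.span_le.mpr ?_ : maximalIdeal R ≤ _) ha
      rintro _ ⟨i, rfl⟩
      exact (Ideal.mem_torsionOf_iff _ _).mpr (hw i))
    exact ⟨t, rfl⟩

end Artinian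

/-! ### Krull's intersection theorem modulo an ideal -/

section Krull

theorem mem_of_forall_mem_sup_maximalIdeal_pow {R : Type*} [CommRing R] [IsLocalRing R]
    [IsNoetherianRing R] {I : Ideal R} {g : R} (h : ∀ N, g ∈ I ⊔ maximalIdeal R ^ N) : g ∈ I := by
  have h1 : Submodule.Quotient.mk (p := I) g ∈
      (⨅ N : ℕ, maximalIdeal R ^ N • ⊤ : Submodule R (R ⧸ I)) := by
    refine (Submodule.mem_iInf _).mpr fun N => ?_
    obtain ⟨a, ha, b, hb, rfl⟩ := Submodule.mem_sup.mp (h N)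
    have h2 : Submodule.Quotient.mk (p := I) (a + b) =
        b • (Submodule.Quotient.mk (1 : R) : R ⧸ I) := by
      rw [← Submodule.Quotient.mk_smul, smul_eq_mul, mul_one, Submodule.Quotient.eq,
        add_sub_cancel_right]
      exact ha
    rw [h2]
    exact Submodule.smul_mem_smul hb Submodule.mem_top
  rwa [Ideal.iInf_pow_smul_eq_bot_of_isLocalRing _ (maximalIdeal.isMaximal R).ne_top,
    Submodule.mem_bot, Submodule.Quotient.mk_eq_zero] at h1

end Krull

/-- The elements of `E` killed by the ideal `I`. -/
def annE {R : Type*} [CommRing R] {n : ℕ} (x : Fin n → R) (I : Ideal R) :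
    Submodule R (TopCoh x) := Submodule.torsionBySet R (TopCoh x) (I : Set R)

theorem mem_annE {R : Type*} [CommRing R] {n : ℕ} {x : Fin n → R} {I : Ideal R} {w : TopCoh x} :
    w ∈ annE x I ↔ ∀ a ∈ I, a • w = 0 := by
  simp [annE, Submodule.mem_torsionBySet_iff]

theorem annE_anti {R : Type*} [CommRing R] {n : ℕ} {x : Fin n → R} {I I' : Ideal R} (h : I ≤ I') :
    annE x I' ≤ annE x I := fun _ hw => mem_annE.mpr fun a ha => mem_annE.mp hw a (h ha)

theorem mem_annE_sup {R : Type*} [CommRing R] {n : ℕ} {x : Fin n → R} {I I' : Ideal R}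
    {w : TopCoh x} : w ∈ annE x (I ⊔ I') ↔ w ∈ annE x I ∧ w ∈ annE x I' := by
  refine ⟨fun h => ⟨annE_anti le_sup_left h, annE_anti le_sup_right h⟩, fun h => ?_⟩
  refine mem_annE.mpr fun a ha => ?_
  obtain ⟨b, hb, c, hc, rfl⟩ := Submodule.mem_sup.mp ha
  rw [add_smul, mem_annE.mp h.1 b hb, mem_annE.mp h.2 c hc, add_zero]

theorem mem_annE_span_singleton {R : Type*} [CommRing R] {n : ℕ} {x : Fin n → R} {u : R}
    {w : TopCoh x} : w ∈ annE x (Ideal.span {u}) ↔ u • w = 0 := by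
  refine ⟨fun h => mem_annE.mp h u (Ideal.mem_span_singleton_self u), fun h => ?_⟩
  refine mem_annE.mpr fun a ha => ?_
  obtain ⟨t, rfl⟩ := Ideal.mem_span_singleton'.mp ha
  rw [mul_smul, h, smul_zero]

/-! ### Duality between ideals and submodules of `E`, with Frobenius powers -/

section Duality

variable {R : Type*} [CommRing R] [IsRegularLocalRing R] {n : ℕ} {x : Fin n → R}
  (p : ℕ) [Fact p.Prime] [CharP R p]

/-- The colength-one step. Some w₀ ∈ Ann_E I has u w₀ equal to the socle generator, and Ann_E I = R
w₀ + Ann_E(I + (u)). As 𝔪 w₀ lies in the second summand, g F^e(w₀) is killed by all x_i^q, where q =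
p^e, hence equals c u^q F^e(w₀) for some c. So g - c u^q kills F^e(Ann_E I) and lies in I^{[q]}. -/
theorem mem_frobPower_sup_span_singleton (hn : ringKrullDim R = n)
    (hx : Ideal.span (Set.range x) = maximalIdeal R) {I : Ideal R} {u : R} (hu : u ∉ I)
    (hmu : ∀ a ∈ maximalIdeal R, a * u ∈ I)
    (hI : ∀ g : R, (∀ w ∈ annE x I, g • w = 0) → g ∈ I) {e : ℕ}
    (hIe : ∀ g : R, (∀ w ∈ annE x I, g • (frobE p x)^[e] w = 0) → g ∈ frobPower I (p ^ e))
    {g : R} (hg : ∀ w ∈ annE x (I ⊔ Ideal.span {u}), g • (frobE p x)^[e] w = 0) :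
    g ∈ frobPower (I ⊔ Ideal.span {u}) (p ^ e) := by
  obtain ⟨w, hw, huw⟩ : ∃ w ∈ annE x I, u • w ≠ 0 := by
    by_contra! h
    exact hu (hI u h)
  obtain ⟨b, hb⟩ := exists_smul_eq_gen_one hn hx huw
  obtain ⟨w₀, hw₀, huw₀⟩ : ∃ w₀ ∈ annE x I, u • w₀ = gen x 1 :=
    ⟨b • w, Submodule.smul_mem _ _ hw, by rw [smul_comm, hb]⟩
  have hdecomp : ∀ v ∈ annE x I, ∃ c : R, v - c • w₀ ∈ annE x (I ⊔ Ideal.span {u}) := by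
    intro v hv
    obtain ⟨c, hc⟩ := eq_smul_gen_one_of_forall_mem_maximalIdeal hn hx (w := u • v) fun a ha => by
      rw [smul_smul]
      exact mem_annE.mp hv _ (hmu a ha)
    refine ⟨c, mem_annE_sup.mpr ⟨sub_mem hv (Submodule.smul_mem _ _ hw₀),
      mem_annE_span_singleton.mpr ?_⟩⟩
    rw [smul_sub, hc, smul_comm u c, huw₀, sub_self]
  have hm : ∀ a ∈ maximalIdeal R, a • w₀ ∈ annE x (I ⊔ Ideal.span {u}) := fun a ha =>
    mem_annE_sup.mpr ⟨Submodule.smul_mem _ _ hw₀, mem_annE_span_singleton.mpr (by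
      rw [smul_smul, mul_comm]; exact mem_annE.mp hw₀ _ (hmu a ha))⟩
  obtain ⟨c, hc⟩ := eq_smul_gen_of_forall_mem_paramIdeal hn hx (d := p ^ e)
    (w := g • (frobE p x)^[e] w₀) fun a ha => by
      rw [← Ideal.mem_torsionOf_iff]
      refine monoIdeal_le_iff.mpr (fun i _ => ?_) ha
      rw [Ideal.mem_torsionOf_iff, smul_comm, ← frobE_iterate_smul]
      exact hg _ (hm _ (hx ▸ Ideal.subset_span ⟨i, rfl⟩))
  have hgen : gen x (p ^ e) = u ^ p ^ e • (frobE p x)^[e] w₀ := by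
    rw [← frobE_iterate_smul, huw₀, frobE_iterate_gen, one_mul]
  have hmem : g - c * u ^ p ^ e ∈ frobPower I (p ^ e) := by
    refine hIe _ fun v hv => ?_
    obtain ⟨c', hv'⟩ := hdecomp v hv
    have hv1 : (g - c * u ^ p ^ e) • (frobE p x)^[e] (v - c' • w₀) = 0 := by
      rw [sub_smul, hg _ hv', mul_smul, ← frobE_iterate_smul,
        mem_annE_span_singleton.mp (mem_annE_sup.mp hv').2, frobE_iterate_zero, smul_zero, sub_zero]
    have hv2 : (g - c * u ^ p ^ e) • (frobE p x)^[e] w₀ = 0 := by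
      rw [sub_smul, hc, mul_smul, ← hgen, sub_self]
    rw [← sub_add_cancel v (c' • w₀), frobE_iterate_add, smul_add, hv1, frobE_iterate_smul,
      smul_comm, hv2, smul_zero, zero_add]
  rw [← sub_add_cancel g (c * u ^ p ^ e)]
  refine Ideal.add_mem _ ?_ (Ideal.mul_mem_left _ _ (pow_mem_frobPower
    (Ideal.mem_sup_right (Ideal.mem_span_singleton_self u)) _))
  rw [frobPower_eq_map] at hmem ⊢
  exact Ideal.map_mono le_sup_left hmem

/-- Below an ideal `I'` properly containing `I` there is an ideal `I₁ ⊇ I` of colength one. -/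
theorem exists_eq_sup_span_singleton {R : Type*} [CommRing R] [IsLocalRing R] [IsNoetherianRing R]
    {I I' : Ideal R} (h : I < I') :
    ∃ I₁ u, I ≤ I₁ ∧ u ∉ I₁ ∧ (∀ a ∈ maximalIdeal R, a * u ∈ I₁) ∧
      I' = I₁ ⊔ Ideal.span {u} := by
  obtain ⟨I₁, ⟨hI, hlt⟩, hmax⟩ := (wellFounded_gt (α := Ideal R)).has_min
    {K | I ≤ K ∧ K < I'} ⟨I, le_rfl, h⟩
  -- Maximality of I₁ below I' leaves only I₁ + 𝔪I' = I₁ or I'; Nakayama rules out the latter.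
  have hsup : I₁ ⊔ maximalIdeal R • I' ≤ I₁ := by
    by_contra hle
    have hne : I₁ ⊔ maximalIdeal R • I' ≠ I' := fun heq =>
      hlt.not_ge (Submodule.le_of_le_smul_of_le_jacobson_bot (IsNoetherian.noetherian I')
        (maximalIdeal_le_jacobson _) heq.ge)
    exact hmax _ ⟨hI.trans le_sup_left,
      lt_of_le_of_ne (sup_le hlt.le Submodule.smul_le_right) hne⟩
      (lt_of_le_not_ge le_sup_left hle)
  obtain ⟨u, hu', hu⟩ := SetLike.exists_of_lt hlt
  refine ⟨I₁, u, hI, hu, fun a ha => hsup (Ideal.mem_sup_right (Submodule.smul_mem_smul ha hu')),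
    ?_⟩
  by_contra hne
  refine hmax (I₁ ⊔ Ideal.span {u}) ⟨hI.trans le_sup_left, lt_of_le_of_ne
    (sup_le hlt.le ((Ideal.span_singleton_le_iff_mem _).mpr hu')) (Ne.symm hne)⟩
    (lt_of_le_not_ge le_sup_left fun hle =>
      hu (hle (Ideal.mem_sup_right (Ideal.mem_span_singleton_self u))))

theorem isArtinianRing_quotient_paramIdeal (hx : Ideal.span (Set.range x) = maximalIdeal R)
    {d : ℕ} (hd : 0 < d) : IsArtinianRing (R ⧸ paramIdeal x d) := by
  have hle : paramIdeal x d ≤ maximalIdeal R := paramIdeal_one hx ▸ paramIdeal_anti hd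
  have : Nontrivial (R ⧸ paramIdeal x d) := Ideal.Quotient.nontrivial_iff.mpr
    (ne_top_of_le_ne_top (maximalIdeal.isMaximal R).ne_top hle)
  have : IsLocalRing (R ⧸ paramIdeal x d) :=
    .of_surjective' (Ideal.Quotient.mk _) Ideal.Quotient.mk_surjective
  rw [isArtinianRing_iff_isNilpotent_maximalIdeal]
  obtain ⟨N, hN⟩ := exists_pow_le_paramIdeal hx d
  refine ⟨N, ?_⟩
  rw [← map_maximalIdeal_of_surjective (Ideal.Quotient.mk (paramIdeal x d))
    Ideal.Quotient.mk_surjective, ← Ideal.map_pow, Ideal.zero_eq_bot, ← le_bot_iff,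
    ← Ideal.map_quotient_self (paramIdeal x d)]
  exact Ideal.map_mono hN

/-- Induction in the Artinian ring R/(x_i^d), climbing by colength one from (x_i^d), where testing
on `gen x d` suffices. The exponent e stays universally quantified because the step also uses e = 0.
-/
theorem mem_frobPower_of_paramIdeal_le (hn : ringKrullDim R = n)
    (hx : Ideal.span (Set.range x) = maximalIdeal R) {d : ℕ} (hd : 0 < d) (I : Ideal R)
    (hI : paramIdeal x d ≤ I) :
    ∀ (e : ℕ) (g : R), (∀ w ∈ annE x I, g • (frobE p x)^[e] w = 0) →
      g ∈ frobPower I (p ^ e) := by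
  have := isArtinianRing_quotient_paramIdeal hx hd
  induction h : I.map (Ideal.Quotient.mk (paramIdeal x d)) using
    (wellFounded_lt (α := Ideal (R ⧸ paramIdeal x d))).induction generalizing I with
  | _ _ ih =>
  subst h
  rcases eq_or_lt_of_le hI with rfl | hlt
  · intro e g hg
    have h1 := hg (gen x d) (mem_annE.mpr fun a ha => smul_gen_eq_zero_of_mem ha)
    rwa [frobE_iterate_gen, smul_gen_eq_zero_iff hn hx, ← frobPower_paramIdeal p] at h1
  · obtain ⟨I₁, u, hI₁, hu, hmu, rfl⟩ := exists_eq_sup_span_singleton hlt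
    have hmap : I₁.map (Ideal.Quotient.mk (paramIdeal x d)) <
        (I₁ ⊔ Ideal.span {u}).map (Ideal.Quotient.mk (paramIdeal x d)) := by
      refine lt_of_le_of_ne (Ideal.map_mono le_sup_left) fun heq => hu ?_
      have h1 := congrArg (Ideal.comap (Ideal.Quotient.mk (paramIdeal x d))) heq
      rw [Ideal.comap_map_mk hI₁, Ideal.comap_map_mk hI] at h1
      rw [h1]
      exact Ideal.mem_sup_right (Ideal.mem_span_singleton_self u)
    have hI₁' := ih _ hmap I₁ hI₁ rfl
    intro e g hg
    refine mem_frobPower_sup_span_singleton p hn hx hu hmu (fun g hg => ?_) (hI₁' e) hg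
    have h1 := hI₁' 0 g hg
    rwa [frobPower_eq_map, iterateFrobenius_zero, Ideal.map_id] at h1

/-- Enlarging I by (x_i^{N+1}) reduces to finite colength; Krull's intersection theorem then removes
the error in 𝔪^N. -/
theorem mem_frobPower_of_forall_annE (hn : ringKrullDim R = n)
    (hx : Ideal.span (Set.range x) = maximalIdeal R) (I : Ideal R) (e : ℕ) {g : R}
    (hg : ∀ w ∈ annE x I, g • (frobE p x)^[e] w = 0) : g ∈ frobPower I (p ^ e) := by
  have hq : 0 < p ^ e := pow_pos (Fact.out : p.Prime).pos e
  refine mem_of_forall_mem_sup_maximalIdeal_pow fun N => ?_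
  have h1 := mem_frobPower_of_paramIdeal_le p hn hx N.succ_pos (I ⊔ paramIdeal x (N + 1))
    le_sup_right e g fun w hw => hg w (annE_anti le_sup_left hw)
  rw [frobPower_eq_map, Ideal.map_sup, ← frobPower_eq_map, ← frobPower_eq_map,
    frobPower_paramIdeal] at h1
  refine sup_le_sup_left ((paramIdeal_anti ?_).trans (paramIdeal_le_pow hx N)) _ h1
  nlinarith

theorem mem_of_forall_annE (p : ℕ) [Fact p.Prime] [CharP R p]
    (hn : ringKrullDim R = n)
    (hx : Ideal.span (Set.range x) = maximalIdeal R) (I : Ideal R) {g : R}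
    (hg : ∀ w ∈ annE x I, g • w = 0) : g ∈ I := by
  have h1 := mem_frobPower_of_forall_annE p hn hx I 0 hg
  rwa [frobPower_eq_map, iterateFrobenius_zero, Ideal.map_id] at h1

/-- A submodule of `E` is closed when it is the annihilator of its annihilator; the submodules
killed by some `(x_1 ^ d, …, x_n ^ d)` are. -/
theorem mem_of_forall_annihilator_smul_eq_zero (p : ℕ) [Fact p.Prime] [CharP R p]
    (hn : ringKrullDim R = n)
    (hx : Ideal.span (Set.range x) = maximalIdeal R) {d : ℕ} {N : Submodule R (TopCoh x)}
    (hN : N ≤ annE x (paramIdeal x d)) {w : TopCoh x} (hw : ∀ a ∈ N.annihilator, a • w = 0) :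
    w ∈ N := by
  obtain ⟨v, rfl⟩ := eq_smul_gen_of_forall_mem_paramIdeal hn hx (d := d) fun a ha =>
    hw a (Submodule.mem_annihilator.mpr fun y hy => mem_annE.mp (hN hy) a ha)
  let I : Ideal R := N.comap (LinearMap.toSpanSingleton R (TopCoh x) (gen x d))
  have hI : ∀ u, u ∈ I ↔ u • gen x d ∈ N := fun u => Iff.rfl
  rw [← hI]
  -- I is the ideal of numerators of N over `gen x d`. If I kills y = t • `gen x d`, then t
  -- annihilates N, so v • y = t • w = 0.
  refine mem_of_forall_annE p hn hx I fun y hy => ?_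
  have hy' := mem_annE.mp hy
  obtain ⟨t, rfl⟩ := eq_smul_gen_of_forall_mem_paramIdeal hn hx (d := d) fun a ha =>
    hy' a ((hI a).mpr (smul_gen_eq_zero_of_mem ha ▸ zero_mem N))
  rw [smul_comm]
  refine hw t (Submodule.mem_annihilator.mpr fun z hz => ?_)
  obtain ⟨u, rfl⟩ := eq_smul_gen_of_forall_mem_paramIdeal hn hx (d := d) fun a ha =>
    mem_annE.mp (hN hz) a ha
  rw [smul_comm]
  exact hy' u ((hI u).mpr hz)

end Duality

/-! ### Double annihilators over a complete ring -/

section Complete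

theorem exists_mem_annE_paramIdeal {R : Type*} [CommRing R] {n : ℕ} {x : Fin n → R}
    (w : TopCoh x) : ∃ d, ∀ k, w ∈ annE x (paramIdeal x (d + k)) := by
  obtain ⟨d, u, rfl⟩ := exists_eq_smul_gen w
  exact ⟨d, fun k => mem_annE.mpr fun a ha =>
    smul_eq_zero_of_mem_paramIdeal (paramIdeal_anti (Nat.le_add_right d k) ha)⟩

variable {R : Type*} [CommRing R] [IsRegularLocalRing R] {n : ℕ} {x : Fin n → R}

/-- Put N_d = N ∩ Ann_E(x_i^d). Since N_d = N_{d+1} ∩ Ann_E(x_i^d) and N_{d+1} is closed, duality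
gives Ann N_d ⊆ Ann N_{d+1} + (x_i^d), which allows lifting from level to level. -/
theorem annihilator_inf_annE_le (p : ℕ) [Fact p.Prime] [CharP R p] (hn : ringKrullDim R = n)
    (hx : Ideal.span (Set.range x) = maximalIdeal R) (N : Submodule R (TopCoh x)) (d : ℕ) :
    (N ⊓ annE x (paramIdeal x d)).annihilator ≤
      (N ⊓ annE x (paramIdeal x (d + 1))).annihilator ⊔ paramIdeal x d := by
  intro a ha
  refine mem_of_forall_annE p hn hx _ fun w hw => ?_
  obtain ⟨hw₁, hw₂⟩ := mem_annE_sup.mp hw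
  have h1 := mem_of_forall_annihilator_smul_eq_zero p hn hx inf_le_right (mem_annE.mp hw₁)
  exact Submodule.mem_annihilator.mp ha w ⟨h1.1, hw₂⟩

theorem mem_of_forall_annihilator_smul_eq_zero_of_isAdicComplete (p : ℕ) [Fact p.Prime]
    [CharP R p] (hn : ringKrullDim R = n) (hx : Ideal.span (Set.range x) = maximalIdeal R)
    [IsAdicComplete (maximalIdeal R) R] {N : Submodule R (TopCoh x)} {w : TopCoh x}
    (hw : ∀ a ∈ N.annihilator, a • w = 0) : w ∈ N := by
  by_contra hwN
  let K : ℕ → Ideal R := fun d => (N ⊓ annE x (paramIdeal x d)).annihilator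
  have hbK : ∀ d, paramIdeal x d ≤ K d := fun d a ha =>
    Submodule.mem_annihilator.mpr fun v hv => mem_annE.mp hv.2 a ha
  obtain ⟨d, hd⟩ := exists_mem_annE_paramIdeal w
  obtain ⟨a, ha, haw⟩ : ∃ a ∈ K d, a • w ≠ 0 := by
    by_contra! h
    exact hwN (mem_of_forall_annihilator_smul_eq_zero p hn hx inf_le_right h).1
  have hstep : ∀ k (b : K (d + k)), ∃ b' : K (d + (k + 1)),
      (b : R) - b' ∈ paramIdeal x (d + k) := by
    rintro k ⟨b, hb⟩
    obtain ⟨b', hb', c, hc, h⟩ := Submodule.mem_sup.mp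
      (annihilator_inf_annE_le p hn hx N (d + k) hb)
    exact ⟨⟨b', hb'⟩, (sub_eq_of_eq_add' h.symm : b - b' = c) ▸ hc⟩
  choose next hnext using hstep
  -- The lifts of a form a Cauchy sequence. Its limit L annihilates all of N and agrees with a on w,
  -- contradicting a • w ≠ 0.
  let s : ∀ k, K (d + k) := fun k => Nat.rec ⟨a, ha⟩ next k
  have hs : ∀ k l : ℕ, k ≤ l → (s k).1 - (s l).1 ∈ paramIdeal x (d + k) := by
    intro k l hkl
    induction l, hkl using Nat.le_induction with
    | base => rw [sub_self]; exact zero_mem _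
    | succ l hkl ih =>
      rw [← sub_add_sub_cancel (s k).1 (s l).1]
      exact add_mem ih (paramIdeal_anti (by omega) (hnext l (s l)))
  obtain ⟨L, hL⟩ := IsPrecomplete.prec' (I := maximalIdeal R) (fun k => (s k).1)
    fun {k l} hkl => by
      rw [SModEq.sub_mem, smul_eq_mul, Ideal.mul_top]
      exact Ideal.pow_le_pow_right (by omega) (paramIdeal_le_pow hx _ (hs k l hkl))
  have hLs : ∀ k, (s k).1 - L ∈ paramIdeal x (d + k) := by
    intro k
    obtain ⟨M, hM⟩ := exists_pow_le_paramIdeal hx (d + k)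
    rw [← sub_add_sub_cancel (s k).1 (s (max k M)).1]
    refine add_mem (hs _ _ (le_max_left _ _)) (hM (Ideal.pow_le_pow_right (le_max_right k M) ?_))
    simpa [SModEq.sub_mem] using hL (max k M)
  have hLN : L ∈ N.annihilator := by
    refine Submodule.mem_annihilator.mpr fun v hv => ?_
    obtain ⟨k, hk⟩ := exists_mem_annE_paramIdeal v
    have h1 : L ∈ K (d + k) := by
      rw [← sub_sub_cancel (s k).1 L]
      exact sub_mem (s k).2 (hbK _ (hLs k))
    exact Submodule.mem_annihilator.mp h1 v ⟨hv, by rw [add_comm]; exact hk d⟩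
  have h0 := mem_annE.mp (hd 0) _ (hLs 0)
  rw [sub_smul, hw L hLN, sub_zero] at h0
  exact haw h0

end Complete

/-! ### Double annihilators when Frobenius is finite -/

section FFinite

/-- In a generating family of least size, a unit coefficient in a combination lying in 𝔪P would make
one generator redundant by Nakayama. -/
theorem exists_minimal_generators (R P : Type*) [CommRing R] [IsLocalRing R] [AddCommGroup P]
    [Module R P] [Module.Finite R P] : ∃ (m : ℕ) (b : Fin m → P),
      Submodule.span R (Set.range b) = ⊤ ∧
      ∀ c : Fin m → R, ∑ i, c i • b i ∈ maximalIdeal R • (⊤ : Submodule R P) →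
        ∀ i, c i ∈ maximalIdeal R := by
  classical
  have hex : ∃ (m : ℕ) (b : Fin m → P), Submodule.span R (Set.range b) = ⊤ :=
    Module.Finite.exists_fin
  obtain ⟨b, hb⟩ := Nat.find_spec hex
  have hmin := fun m => Nat.find_min hex (m := m)
  revert b
  generalize Nat.find hex = m at hmin
  intro b hb
  refine ⟨m, b, hb, fun c hc i => ?_⟩
  by_contra hi
  obtain ⟨k, rfl⟩ : ∃ k, m = k + 1 := ⟨m - 1, by have := i.pos; omega⟩
  refine hmin k k.lt_succ_self ⟨b ∘ i.succAbove, top_le_iff.mp ?_⟩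
  refine Submodule.le_of_le_smul_of_le_jacobson_bot (I := maximalIdeal R) Module.Finite.fg_top
    (maximalIdeal_le_jacobson _) ?_
  rw [← hb, Submodule.span_le]
  rw [Fin.sum_univ_succAbove _ i] at hc
  have hu : IsUnit (c i) := by simpa using hi
  have hbi : b i ∈ Submodule.span R (Set.range (b ∘ i.succAbove)) ⊔
      maximalIdeal R • (⊤ : Submodule R P) := by
    rw [← Submodule.smul_mem_iff_of_isUnit _ hu]
    rw [← add_sub_cancel_right (c i • b i) (∑ j, c (i.succAbove j) • b (i.succAbove j))]
    exact sub_mem (Submodule.mem_sup_right hc) (Submodule.mem_sup_left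
      (Submodule.sum_mem _ fun j _ => Submodule.smul_mem _ _ (Submodule.subset_span ⟨j, rfl⟩)))
  rintro _ ⟨j, rfl⟩
  rw [hb]
  induction j using Fin.succAboveCases i with
  | x => exact hbi
  | p j => exact Submodule.mem_sup_left (Submodule.subset_span ⟨j, rfl⟩)

/-- The map φ is kept explicit because it will be an iterated Frobenius of `R`, whose induced module
structure must not be confused with the usual one. -/
theorem exists_minimal_generators_of_finite {R S : Type*} [CommRing R] [IsLocalRing R]
    [CommRing S] (φ : R →+* S) (hφ : φ.Finite) : ∃ (m : ℕ) (b : Fin m → S),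
      (∀ g : S, ∃ c : Fin m → R, ∑ i, φ (c i) * b i = g) ∧
      ∀ c : Fin m → R, ∑ i, φ (c i) * b i ∈ (maximalIdeal R).map φ →
        ∀ i, c i ∈ maximalIdeal R := by
  let := φ.toAlgebra
  have : Module.Finite R S := hφ
  have halg : algebraMap R S = φ := RingHom.algebraMap_toAlgebra φ
  obtain ⟨m, b, hb, hmin⟩ := exists_minimal_generators R S
  refine ⟨m, b, fun g => ?_, fun c hc => hmin c ?_⟩
  · obtain ⟨c, hc⟩ := (Submodule.mem_span_range_iff_exists_fun R).mp (hb ▸ Submodule.mem_top :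
      g ∈ Submodule.span R (Set.range b))
    exact ⟨c, by simpa only [Algebra.smul_def, halg] using hc⟩
  · rw [Ideal.smul_top_eq_map, Submodule.restrictScalars_mem]
    simpa only [Algebra.smul_def, halg] using hc

theorem finite_iterateFrobenius {R : Type*} [CommRing R] {p : ℕ} [Fact p.Prime] [CharP R p]
    (h : (frobenius R p).Finite) (e : ℕ) : (iterateFrobenius R p e).Finite := by
  induction e with
  | zero => rw [iterateFrobenius_zero]; exact RingHom.Finite.id R
  | succ e ih =>
    have : iterateFrobenius R p (e + 1) = (frobenius R p).comp (iterateFrobenius R p e) := by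
      ext a
      simp [iterateFrobenius_def, frobenius_def, pow_succ, pow_mul]
    rw [this]
    exact h.comp ih

variable {R : Type*} [CommRing R] [IsRegularLocalRing R] {n : ℕ} {x : Fin n → R}
  {p : ℕ} [Fact p.Prime] [CharP R p]

/-- A nonzero solution can be multiplied into the socle, with entries t_i • `gen x 1` not all zero.
Then ∑ t_i^q b_i ∈ 𝔪^{[q]} for q = p^e, and minimality of the generators puts every t_i in 𝔪. -/
theorem eq_zero_of_sum_smul_frobE_iterate_eq_zero (hn : ringKrullDim R = n)
    (hx : Ideal.span (Set.range x) = maximalIdeal R) {e m : ℕ} {b : Fin m → R}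
    (hb : ∀ c : Fin m → R, ∑ i, iterateFrobenius R p e (c i) * b i ∈
      (maximalIdeal R).map (iterateFrobenius R p e) → ∀ i, c i ∈ maximalIdeal R)
    {w : Fin m → TopCoh x} (hw : ∑ i, b i • (frobE p x)^[e] (w i) = 0) : w = 0 := by
  by_contra hw0
  choose N hN using fun i => exists_pow_smul_eq_zero hx (w i)
  obtain ⟨c, hc0, hc⟩ := exists_smul_ne_zero_of_pow_smul_eq_zero (I := maximalIdeal R) hw0
    (N := Finset.univ.sup N) fun a ha => funext fun i =>
      hN i a (Ideal.pow_le_pow_right (Finset.le_sup (Finset.mem_univ i)) ha)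
  choose t ht using fun i => eq_smul_gen_one_of_forall_mem_maximalIdeal hn hx (w := c • w i)
    fun a ha => congrFun (hc a ha) i
  have hsum : ∑ i, iterateFrobenius R p e (t i) * b i ∈
      (maximalIdeal R).map (iterateFrobenius R p e) := by
    have h1 : (∑ i, iterateFrobenius R p e (t i) * b i) • gen x (p ^ e) =
        c ^ p ^ e • ∑ i, b i • (frobE p x)^[e] (w i) := by
      rw [Finset.sum_smul, Finset.smul_sum]
      refine Finset.sum_congr rfl fun i _ => ?_
      rw [smul_comm (c ^ p ^ e), ← frobE_iterate_smul, ht, frobE_iterate_smul_gen, one_mul,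
        iterateFrobenius_def, mul_comm, mul_smul]
    rw [hw, smul_zero, smul_gen_eq_zero_iff hn hx] at h1
    rwa [← paramIdeal_one hx, ← frobPower_eq_map, frobPower_paramIdeal, one_mul]
  refine hc0 (funext fun i => ?_)
  have h2 := hb t hsum i
  rw [← paramIdeal_one hx] at h2
  exact (ht i).trans (smul_gen_eq_zero_of_mem h2)

theorem mem_Z_span_singleton {R : Type*} [CommRing R] {p : ℕ} [Fact p.Prime] [CharP R p] {n : ℕ}
    {x : Fin n → R} {f : R} {r e : ℕ} {w : TopCoh x} :
    w ∈ Z p x (Ideal.span {f}) r e ↔ f ^ r • (frobE p x)^[e] w = 0 := by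
  change (∀ h ∈ Ideal.span {f} ^ r, h • (frobE p x)^[e] w = 0) ↔ _
  rw [Ideal.span_singleton_pow]
  exact mem_annE.symm.trans mem_annE_span_singleton

/-- Expanding f^r = ∑ c_i^q b_i, with q = p^e, in minimal generators gives f^r F^e(v) = ∑ b_i
F^e(c_i v), so Z_{r,e} is the annihilator in `E` of (c_1, …, c_m). -/
theorem mem_Z_of_forall_annihilator_smul_eq_zero (hn : ringKrullDim R = n)
    (hx : Ideal.span (Set.range x) = maximalIdeal R) (hfin : (frobenius R p).Finite) {f : R}
    {r e : ℕ} {w : TopCoh x} (hw : ∀ a ∈ (Z p x (Ideal.span {f}) r e).annihilator, a • w = 0) :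
    w ∈ Z p x (Ideal.span {f}) r e := by
  obtain ⟨m, b, hspan, hb⟩ := exists_minimal_generators_of_finite _ (finite_iterateFrobenius hfin e)
  obtain ⟨c, hc⟩ := hspan (f ^ r)
  have hsmul : ∀ v : TopCoh x, f ^ r • (frobE p x)^[e] v =
      ∑ i, b i • (frobE p x)^[e] (c i • v) := by
    intro v
    rw [← hc, Finset.sum_smul]
    refine Finset.sum_congr rfl fun i _ => ?_
    rw [frobE_iterate_smul, iterateFrobenius_def, mul_comm, mul_smul]
  rw [mem_Z_span_singleton, hsmul]
  refine Finset.sum_eq_zero fun i _ => ?_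
  rw [hw (c i), frobE_iterate_zero, smul_zero]
  refine Submodule.mem_annihilator.mpr fun v hv => ?_
  rw [mem_Z_span_singleton, hsmul] at hv
  exact congrFun (eq_zero_of_sum_smul_frobE_iterate_eq_zero hn hx hb hv) i

end FFinite

/-! ### Existence of F-thresholds -/

section FThreshold

variable {R : Type*} [CommRing R]

theorem notMem_span_singleton_pow_le_iff {f : R} {r : ℕ} {I : Ideal R} :
    ¬ Ideal.span {f} ^ r ≤ I ↔ f ^ r ∉ I := by
  rw [Ideal.span_singleton_pow, Ideal.span_singleton_le_iff_mem]

theorem pow_mem_frobPower_of_le {f : R} {I : Ideal R} {q r s : ℕ} (h : f ^ r ∈ frobPower I q)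
    (hrs : r ≤ s) : f ^ s ∈ frobPower I q :=
  Ideal.pow_mem_of_pow_mem _ h hrs

theorem frobPower_le_maximalIdeal [IsLocalRing R] {I : Ideal R} (hI : I ≠ ⊤) {q : ℕ}
    (hq : q ≠ 0) : frobPower I q ≤ maximalIdeal R := by
  refine Ideal.span_le.mpr ?_
  rintro _ ⟨y, hy, rfl⟩
  exact Ideal.pow_mem_of_mem _ (le_maximalIdeal hI hy) q (Nat.pos_of_ne_zero hq)

theorem isGreatest_nu [IsLocalRing R] {f : R} {I : Ideal R} (hI : I ≠ ⊤) (hf : f ∈ I.radical)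
    {q : ℕ} (hq : q ≠ 0) :
    IsGreatest {r : ℕ | ¬ Ideal.span {f} ^ r ≤ frobPower I q} (nu (Ideal.span {f}) I q) := by
  simp only [nu, notMem_span_singleton_pow_le_iff]
  obtain ⟨N, hN⟩ := hf
  have hbdd : BddAbove {r : ℕ | f ^ r ∉ frobPower I q} := by
    refine ⟨N * q, fun r hr => ?_⟩
    by_contra! hlt
    exact hr (pow_mem_frobPower_of_le (by rw [pow_mul]; exact pow_mem_frobPower hN q) hlt.le)
  refine ⟨Nat.sSup_mem ⟨0, fun h => ?_⟩ hbdd, fun r hr => le_csSup hbdd hr⟩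
  exact (maximalIdeal.isMaximal R).ne_top ((Ideal.eq_top_iff_one _).mpr
    (frobPower_le_maximalIdeal hI hq (by simpa using h)))

variable (p : ℕ) [Fact p.Prime] [CharP R p]

theorem pow_mul_mem_frobPower_succ {f : R} {I : Ideal R} {r e : ℕ}
    (h : f ^ r ∈ frobPower I (p ^ e)) : f ^ (p * r) ∈ frobPower I (p ^ (e + 1)) := by
  rw [frobPower_eq_map] at h ⊢
  have h1 := Ideal.mem_map_of_mem (frobenius R p) h
  have h2 : (frobenius R p).comp (iterateFrobenius R p e) = iterateFrobenius R p (e + 1) := by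
    ext a
    simp [iterateFrobenius_def, frobenius_def, pow_succ, pow_mul]
  rwa [Ideal.map_map, h2, frobenius_def, ← pow_mul, mul_comm] at h1

/-- Because f^{ν+1} ∈ I^{[q]} implies f^{p(ν+1)} ∈ I^{[pq]}, the sequence (ν + 1)/p^e decreases; the
correction 1/p^e tends to 0. -/
theorem exists_tendsto_nu_div [IsLocalRing R] {f : R} {I : Ideal R} (hI : I ≠ ⊤)
    (hf : f ∈ I.radical) : ∃ l : ℝ, Tendsto (fun e : ℕ =>
      (nu (Ideal.span {f}) I (p ^ e) : ℝ) / (p : ℝ) ^ e) atTop (𝓝 l) := by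
  have hp1 : 1 < p := (Fact.out : p.Prime).one_lt
  have hp0 : (0 : ℝ) < p := by exact_mod_cast hp1.trans' one_pos
  have hnu := fun e => isGreatest_nu hI hf (q := p ^ e) (pow_ne_zero e (by omega))
  have hstep : ∀ e, nu (Ideal.span {f}) I (p ^ (e + 1)) + 1 ≤
      p * (nu (Ideal.span {f}) I (p ^ e) + 1) := by
    intro e
    by_contra! hlt
    have h1 : f ^ (nu (Ideal.span {f}) I (p ^ e) + 1) ∈ frobPower I (p ^ e) := by
      by_contra h
      exact absurd ((hnu e).2 (notMem_span_singleton_pow_le_iff.mpr h)) (by omega)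
    exact notMem_span_singleton_pow_le_iff.mp (hnu (e + 1)).1
      (pow_mem_frobPower_of_le (pow_mul_mem_frobPower_succ p h1) (by omega))
  have hanti : Antitone fun e : ℕ =>
      ((nu (Ideal.span {f}) I (p ^ e) : ℝ) + 1) / (p : ℝ) ^ e := by
    refine antitone_nat_of_succ_le fun e => ?_
    rw [div_le_div_iff₀ (by positivity) (by positivity), pow_succ' (p : ℝ), ← mul_assoc,
      mul_comm _ (p : ℝ)]
    refine mul_le_mul_of_nonneg_right ?_ (by positivity)
    exact_mod_cast hstep e
  have hlim := tendsto_atTop_ciInf hanti ⟨0, by rintro _ ⟨e, rfl⟩; positivity⟩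
  have hinv : Tendsto (fun e : ℕ => ((p : ℝ)⁻¹) ^ e) atTop (𝓝 0) :=
    tendsto_pow_atTop_nhds_zero_of_lt_one (by positivity)
      (inv_lt_one_of_one_lt₀ (by exact_mod_cast hp1))
  refine ⟨_, (hlim.sub hinv).congr fun e => ?_⟩
  rw [add_div, inv_pow, one_div, add_sub_cancel_right]

theorem tendsto_nu_div_fThreshold [IsLocalRing R] {f : R} {I : Ideal R} (hI : I ≠ ⊤)
    (hf : f ∈ I.radical) : Tendsto (fun e : ℕ =>
      (nu (Ideal.span {f}) I (p ^ e) : ℝ) / (p : ℝ) ^ e) atTop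
        (𝓝 (fThreshold p (Ideal.span {f}) I)) :=
  tendsto_nhds_limUnder (exists_tendsto_nu_div p hI hf)

theorem fThreshold_top (p : ℕ) [Fact p.Prime] (𝔞 : Ideal R) : fThreshold p 𝔞 ⊤ = 0 := by
  have hnu : ∀ q, nu 𝔞 (⊤ : Ideal R) q = 0 := by
    intro q
    have : frobPower (⊤ : Ideal R) q = ⊤ :=
      (Ideal.eq_top_iff_one _).mpr (by simpa using pow_mem_frobPower (Submodule.mem_top (x := (1 : R))) q)
    simp [nu, this]
  simp only [fThreshold, hnu, Nat.cast_zero, zero_div]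
  exact tendsto_const_nhds.limUnder_eq

end FThreshold

/-! ### Enumerating a well-founded chain from below -/

section Chains

variable {α : Type*} [CompleteLattice α] {F : Set α}

theorem isLeast_sInf_of_forall_le_or_le [WellFoundedLT α]
    (hF : ∀ a ∈ F, ∀ b ∈ F, a ≤ b ∨ b ≤ a) {S : Set α} (hS : S ⊆ F) (hne : S.Nonempty) : IsLeast S (sInf S) := by
  obtain ⟨a, ha, hmin⟩ := (wellFounded_lt (α := α)).has_min S hne
  have hleast : IsLeast S a := ⟨ha, fun b hb => (hF a (hS ha) b (hS hb)).elim id fun h =>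
    (eq_of_le_of_not_lt h (hmin b hb)).ge⟩
  rwa [hleast.isGLB.sInf_eq]

theorem isLeast_of_eq_sInf [WellFoundedLT α]
    (hF : ∀ a ∈ F, ∀ b ∈ F, a ≤ b ∨ b ≤ a) (hne : F.Nonempty)
    (hmax : ∀ a ∈ F, ∃ b ∈ F, a < b) {u : ℕ → α}
    (hu : ∀ m, u m = sInf {a | a ∈ F ∧ ∀ j < m, a ≠ u j}) (m : ℕ) :
    IsLeast {a | a ∈ F ∧ ∀ j < m, a ≠ u j} (u m) := by
  induction m using Nat.strong_induction_on with
  | _ m ih =>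
  -- Nonemptiness of the set being minimized: a chain without greatest element has a member strictly
  -- above any finitely many.
  have hbound : ∀ k ≤ m, ∃ b ∈ F, ∀ j < k, u j < b := by
    intro k hk
    induction k with
    | zero => exact hne.imp fun b hb => ⟨hb, by simp⟩
    | succ k ihk =>
      obtain ⟨b, hb, hlt⟩ := ihk (by omega)
      obtain ⟨b', hb', hlt'⟩ := hmax (u k) (ih k hk).1.1
      rcases hF b hb b' hb' with h | h
      · refine ⟨b', hb', fun j hj => ?_⟩
        rcases Nat.lt_succ_iff_lt_or_eq.mp hj with hj | rfl
        · exact (hlt j hj).trans_le h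
        · exact hlt'
      · refine ⟨b, hb, fun j hj => ?_⟩
        rcases Nat.lt_succ_iff_lt_or_eq.mp hj with hj | rfl
        · exact hlt j hj
        · exact hlt'.trans_le h
  obtain ⟨b, hb, hlt⟩ := hbound m le_rfl
  rw [hu m]
  exact isLeast_sInf_of_forall_le_or_le hF (fun a ha => ha.1) ⟨b, hb, fun j hj => (hlt j hj).ne'⟩

theorem strictMono_of_isLeast {u : ℕ → α}
    (hu : ∀ m, IsLeast {a | a ∈ F ∧ ∀ j < m, a ≠ u j} (u m)) : StrictMono u := fun i j hij =>
  lt_of_le_of_ne ((hu i).2 ⟨(hu j).1.1, fun k hk => (hu j).1.2 k (hk.trans hij)⟩)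
    ((hu j).1.2 i hij).symm

/-- The enumeration skips nothing: each member of F is at most u_{i-1} or at least u_i. -/
theorem le_iff_not_le_of_isLeast {u : ℕ → α}
    (hu : ∀ m, IsLeast {a | a ∈ F ∧ ∀ j < m, a ≠ u j} (u m)) {i : ℕ} (hi : 1 ≤ i) {a : α}
    (ha : a ∈ F) : a ≤ u (i - 1) ↔ ¬ u i ≤ a := by
  have hmono := strictMono_of_isLeast hu
  refine ⟨fun h h' => ((h'.trans h).trans_lt (hmono (by omega : i - 1 < i))).false, fun h => ?_⟩
  by_contra hle
  exact h ((hu i).2 ⟨ha, fun j hj heq => hle (heq ▸ hmono.monotone (by omega))⟩)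

end Chains

/-! ### The family Z_{r,e} and the chain M_i -/

section Family

variable {R : Type*} [CommRing R] {n : ℕ} {x : Fin n → R} {p : ℕ} [Fact p.Prime] [CharP R p]
  {f : R}

theorem Z_mono {r s : ℕ} (h : r ≤ s) (e : ℕ) :
    Z p x (Ideal.span {f}) r e ≤ Z p x (Ideal.span {f}) s e := fun w hw => by
  rw [mem_Z_span_singleton] at hw ⊢
  obtain ⟨k, rfl⟩ := Nat.exists_eq_add_of_le' h
  rw [pow_add, mul_smul, hw, smul_zero]

theorem M_eq_sInf (m : ℕ) :
    M p x f m = sInf {N | N ∈ family p x f ∧ ∀ j < m, N ≠ M p x f j} := by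
  rw [M]
  congr 1
  ext N
  exact and_congr_right fun _ => ⟨fun h j hj => h ⟨j, hj⟩, fun h j => h j j.isLt⟩

theorem smul_frobE_iterate_eq_zero_of_mem_frobPower {N : Submodule R (TopCoh x)} {e : ℕ} {g : R}
    (hg : g ∈ frobPower N.annihilator (p ^ e)) {w : TopCoh x} (hw : w ∈ N) :
    g • (frobE p x)^[e] w = 0 := by
  rw [← Ideal.mem_torsionOf_iff]
  refine Ideal.span_le.mpr ?_ hg
  rintro _ ⟨y, hy, rfl⟩
  change y ^ p ^ e ∈ Ideal.torsionOf R _ _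
  rw [Ideal.mem_torsionOf_iff, ← frobE_iterate_smul, Submodule.mem_annihilator.mp hy w hw,
    frobE_iterate_zero]

end Family

section RegularFamily

variable {R : Type*} [CommRing R] [IsRegularLocalRing R] {n : ℕ} {x : Fin n → R} {p : ℕ}
  [Fact p.Prime] [CharP R p] {f : R}

/-- Apply F^k to f^r F^e(w) and use injectivity; with a common e, comparing two members amounts to
comparing exponents. -/
theorem Z_eq_Z_add (hn : ringKrullDim R = n) (hx : Ideal.span (Set.range x) = maximalIdeal R)
    (r e k : ℕ) : Z p x (Ideal.span {f}) r e = Z p x (Ideal.span {f}) (r * p ^ k) (k + e) := by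
  ext w
  rw [mem_Z_span_singleton, mem_Z_span_singleton, Function.iterate_add_apply, pow_mul,
    ← frobE_iterate_smul, frobE_iterate_eq_zero_iff p hn hx]

theorem family_le_or_le (hn : ringKrullDim R = n) (hx : Ideal.span (Set.range x) = maximalIdeal R) :
    ∀ N ∈ family p x f, ∀ N' ∈ family p x f, N ≤ N' ∨ N' ≤ N := by
  rintro _ ⟨r, e, -, rfl⟩ _ ⟨s, k, -, rfl⟩
  rw [Z_eq_Z_add hn hx r e k, Z_eq_Z_add hn hx s k e, add_comm e k]
  exact (le_total (r * p ^ k) (s * p ^ e)).imp (fun h => Z_mono h _) (fun h => Z_mono h _)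

theorem exists_mem_Z (hx : Ideal.span (Set.range x) = maximalIdeal R) (hf : f ∈ maximalIdeal R)
    (e : ℕ) (w : TopCoh x) : ∃ r, w ∈ Z p x (Ideal.span {f}) r e := by
  obtain ⟨N, hN⟩ := exists_pow_smul_eq_zero hx ((frobE p x)^[e] w)
  exact ⟨N, mem_Z_span_singleton.mpr (hN _ (Ideal.pow_mem_pow hf N))⟩

/-- Otherwise f^r would kill every F^e(`gen x d`), hence lie in arbitrarily high powers of 𝔪 and
vanish. -/
theorem Z_ne_top (hn : ringKrullDim R = n) (hx : Ideal.span (Set.range x) = maximalIdeal R)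
    (hf0 : f ≠ 0) (r e : ℕ) : Z p x (Ideal.span {f}) r e ≠ ⊤ := by
  intro htop
  have := isDomain_of_isRegularLocalRing R
  refine pow_ne_zero r hf0 (Ideal.mem_bot.mp (mem_of_forall_mem_sup_maximalIdeal_pow fun d => ?_))
  have h1 : gen x d ∈ Z p x (Ideal.span {f}) r e := htop ▸ Submodule.mem_top
  rw [mem_Z_span_singleton, frobE_iterate_gen, smul_gen_eq_zero_iff hn hx] at h1
  exact Ideal.mem_sup_right (paramIdeal_le_pow hx d (paramIdeal_anti
    (Nat.le_mul_of_pos_right d (pow_pos (Fact.out : p.Prime).pos e)) h1))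

theorem exists_lt_mem_family (hn : ringKrullDim R = n)
    (hx : Ideal.span (Set.range x) = maximalIdeal R) (hf0 : f ≠ 0) (hf : f ∈ maximalIdeal R) :
    ∀ N ∈ family p x f, ∃ N' ∈ family p x f, N < N' := by
  rintro _ ⟨r, e, he, rfl⟩
  obtain ⟨w, -, hw⟩ := SetLike.exists_of_lt (Z_ne_top (p := p) hn hx hf0 r e).lt_top
  obtain ⟨s, hs⟩ := exists_mem_Z (p := p) hx hf e w
  have hmem : Z p x (Ideal.span {f}) s e ∈ family p x f := ⟨s, e, he, rfl⟩
  refine ⟨_, hmem, lt_of_le_not_ge ?_ fun h => hw (h hs)⟩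
  exact (family_le_or_le hn hx _ ⟨r, e, he, rfl⟩ _ hmem).resolve_right fun h => hw (h hs)

theorem Z_zero (hn : ringKrullDim R = n) (hx : Ideal.span (Set.range x) = maximalIdeal R)
    (e : ℕ) : Z p x (Ideal.span {f}) 0 e = ⊥ := by
  ext w
  rw [mem_Z_span_singleton, pow_zero, one_smul, frobE_iterate_eq_zero_iff p hn hx,
    Submodule.mem_bot]

theorem isLeast_M (hn : ringKrullDim R = n) (hx : Ideal.span (Set.range x) = maximalIdeal R)
    (hf0 : f ≠ 0) (hf : f ∈ maximalIdeal R) (m : ℕ) :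
    IsLeast {N | N ∈ family p x f ∧ ∀ j < m, N ≠ M p x f j} (M p x f m) := by
  have := isArtinian_topCoh hn hx
  exact isLeast_of_eq_sInf (family_le_or_le hn hx) ⟨_, 0, 1, le_rfl, rfl⟩
    (exists_lt_mem_family hn hx hf0 hf) M_eq_sInf m

theorem M_zero (hn : ringKrullDim R = n) (hx : Ideal.span (Set.range x) = maximalIdeal R)
    (hf0 : f ≠ 0) (hf : f ∈ maximalIdeal R) : M p x f 0 = ⊥ :=
  le_bot_iff.mp ((isLeast_M hn hx hf0 hf 0).2 ⟨⟨0, 1, le_rfl, (Z_zero hn hx 1).symm⟩, by simp⟩)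

theorem pow_mem_annihilator_Z (hn : ringKrullDim R = n)
    (hx : Ideal.span (Set.range x) = maximalIdeal R) (r e : ℕ) :
    f ^ r ∈ (Z p x (Ideal.span {f}) r e).annihilator := by
  refine Submodule.mem_annihilator.mpr fun w hw => ?_
  rw [← frobE_iterate_eq_zero_iff p hn hx (e := e), frobE_iterate_smul, ← pow_mul]
  exact mem_Z_span_singleton.mp (Z_mono
    (Nat.le_mul_of_pos_right r (pow_pos (Fact.out : p.Prime).pos e)) e hw)

theorem mem_radical_J (hn : ringKrullDim R = n) (hx : Ideal.span (Set.range x) = maximalIdeal R)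
    (hf0 : f ≠ 0) (hf : f ∈ maximalIdeal R) (i : ℕ) : f ∈ (J p x f i).radical := by
  obtain ⟨r, e, -, h⟩ := (isLeast_M (p := p) hn hx hf0 hf i).1.1
  exact ⟨r, by rw [J, h]; exact pow_mem_annihilator_Z hn hx r e⟩

theorem J_ne_top (hn : ringKrullDim R = n) (hx : Ideal.span (Set.range x) = maximalIdeal R)
    (hf0 : f ≠ 0) (hf : f ∈ maximalIdeal R) {i : ℕ} (hi : 1 ≤ i) : J p x f i ≠ ⊤ := by
  rw [J, Ne, Submodule.annihilator_eq_top_iff, ← M_zero (p := p) hn hx hf0 hf]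
  exact (strictMono_of_isLeast (isLeast_M hn hx hf0 hf) hi).ne'

theorem isGreatest_nuChain (hn : ringKrullDim R = n)
    (hx : Ideal.span (Set.range x) = maximalIdeal R) (hf0 : f ≠ 0) (hf : f ∈ maximalIdeal R)
    {i : ℕ} (hi : 1 ≤ i) (e : ℕ) :
    IsGreatest {r : ℕ | Z p x (Ideal.span {f}) r e ≤ M p x f (i - 1)} (nuChain p x f i e) := by
  have hbdd : BddAbove {r : ℕ | Z p x (Ideal.span {f}) r e ≤ M p x f (i - 1)} := by
    obtain ⟨w, -, hw⟩ := SetLike.exists_of_lt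
      (strictMono_of_isLeast (isLeast_M (p := p) hn hx hf0 hf) (by omega : i - 1 < i))
    obtain ⟨s, hs⟩ := exists_mem_Z (p := p) hx hf e w
    refine ⟨s, fun r hr => ?_⟩
    by_contra! hlt
    exact hw (hr (Z_mono hlt.le e hs))
  exact ⟨Nat.sSup_mem ⟨0, (Z_zero hn hx e).trans_le bot_le⟩ hbdd, fun r hr => le_csSup hbdd hr⟩

/-- Both sets of exponents r say that f^r does not kill F^e(M_i). Closedness `hcl` is needed only to
pass from f^r F^e(M_i) = 0 to f^r ∈ J_i^{[p^e]}. -/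
theorem nuChain_eq_nu (hn : ringKrullDim R = n) (hx : Ideal.span (Set.range x) = maximalIdeal R)
    (hf0 : f ≠ 0) (hf : f ∈ maximalIdeal R) {i : ℕ} (hi : 1 ≤ i)
    (hcl : ∀ w : TopCoh x, (∀ a ∈ J p x f i, a • w = 0) → w ∈ M p x f i) {e : ℕ} (he : 1 ≤ e) :
    nuChain p x f i e = nu (Ideal.span {f}) (J p x f i) (p ^ e) := by
  rw [nuChain, nu]
  congr 1
  ext r
  rw [Set.mem_ofPred, Set.mem_ofPred,
    le_iff_not_le_of_isLeast (isLeast_M hn hx hf0 hf) hi ⟨r, e, he, rfl⟩,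
    notMem_span_singleton_pow_le_iff, not_iff_not]
  constructor
  · intro h
    exact mem_frobPower_of_forall_annE p hn hx _ e fun w hw =>
      mem_Z_span_singleton.mp (h (hcl w (mem_annE.mp hw)))
  · intro h w hw
    exact mem_Z_span_singleton.mpr (smul_frobE_iterate_eq_zero_of_mem_frobPower h hw)

theorem mem_M_of_forall_J_smul_eq_zero (hn : ringKrullDim R = n)
    (hx : Ideal.span (Set.range x) = maximalIdeal R) (hf0 : f ≠ 0) (hf : f ∈ maximalIdeal R)
    (h : (frobenius R p).Finite ∨ IsAdicComplete (maximalIdeal R) R) (i : ℕ) (w : TopCoh x)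
    (hw : ∀ a ∈ J p x f i, a • w = 0) : w ∈ M p x f i := by
  rcases h with h | h
  · obtain ⟨r, e, -, hM⟩ := (isLeast_M (p := p) hn hx hf0 hf i).1.1
    rw [J, hM] at hw
    rw [hM]
    exact mem_Z_of_forall_annihilator_smul_eq_zero hn hx h hw
  · exact mem_of_forall_annihilator_smul_eq_zero_of_isAdicComplete p hn hx hw

end RegularFamily

/-! ### Test ideals as annihilators of members of the family -/

section TestIdeals

variable {R : Type*} [CommRing R] [IsRegularLocalRing R] {n : ℕ} {x : Fin n → R} {p : ℕ}
  [Fact p.Prime] [CharP R p] {f : R}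

/-- After rewriting level e at level e + 1, this is ⌈c p^{e+1}⌉ ≤ p ⌈c p^e⌉. -/
theorem antitone_Z_ceil (hn : ringKrullDim R = n) (hx : Ideal.span (Set.range x) = maximalIdeal R)
    (c : ℝ) : Antitone fun e : ℕ => Z p x (Ideal.span {f}) ⌈c * (p : ℝ) ^ e⌉₊ e := by
  refine antitone_nat_of_succ_le fun e => ?_
  rw [Z_eq_Z_add hn hx _ e 1, add_comm 1 e]
  refine Z_mono (Nat.ceil_le.mpr ?_) _
  rw [Nat.cast_mul, pow_one, pow_succ, ← mul_assoc]
  exact mul_le_mul_of_nonneg_right (Nat.le_ceil _) (Nat.cast_nonneg p)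

theorem iInf_Z_ceil_mem_family (hn : ringKrullDim R = n)
    (hx : Ideal.span (Set.range x) = maximalIdeal R) (c : ℝ) :
    (⨅ (e : ℕ) (_ : 1 ≤ e), Z p x (Ideal.span {f}) ⌈c * (p : ℝ) ^ e⌉₊ e) ∈ family p x f := by
  have := isArtinian_topCoh hn hx
  have hanti := antitone_Z_ceil (p := p) (f := f) hn hx c
  obtain ⟨e₀, h₀⟩ := IsArtinian.monotone_stabilizes
    (⟨fun e => OrderDual.toDual (Z p x (Ideal.span {f}) ⌈c * (p : ℝ) ^ e⌉₊ e),
      fun i j h => hanti h⟩ : ℕ →o (Submodule R (TopCoh x))ᵒᵈ)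
  have h₁ : ∀ e ≥ e₀, Z p x (Ideal.span {f}) ⌈c * (p : ℝ) ^ e₀⌉₊ e₀ =
      Z p x (Ideal.span {f}) ⌈c * (p : ℝ) ^ e⌉₊ e := fun e he => h₀ e he
  -- The index e₀ + 1 guarantees e ≥ 1, as membership in the family requires.
  refine ⟨_, e₀ + 1, by omega, le_antisymm (iInf₂_le (e₀ + 1) (by omega)) (le_iInf₂ fun e _ => ?_)⟩
  rw [← h₁ (e₀ + 1) (by omega), h₁ (max e₀ e) (le_max_left _ _)]
  exact hanti (le_max_right _ _)

/-- For c = r/p^e the ceiling at level k + e is exactly r p^k, so the decreasing sequence is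
constant from level e on. -/
theorem iInf_Z_ceil_eq (hn : ringKrullDim R = n) (hx : Ideal.span (Set.range x) = maximalIdeal R)
    (r : ℕ) {e : ℕ} (he : 1 ≤ e) :
    (⨅ (k : ℕ) (_ : 1 ≤ k), Z p x (Ideal.span {f}) ⌈(r : ℝ) / (p : ℝ) ^ e * (p : ℝ) ^ k⌉₊ k) =
      Z p x (Ideal.span {f}) r e := by
  have hp0 : (p : ℝ) ≠ 0 := by exact_mod_cast (Fact.out : p.Prime).ne_zero
  have hceil : ∀ k, ⌈(r : ℝ) / (p : ℝ) ^ e * (p : ℝ) ^ (k + e)⌉₊ = r * p ^ k := by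
    intro k
    rw [← Nat.ceil_natCast (R := ℝ) (r * p ^ k)]
    congr 1
    push_cast
    field_simp
    ring
  refine le_antisymm ((iInf₂_le e he).trans_eq ?_) (le_iInf₂ fun k _ => ?_)
  · have := hceil 0
    rw [zero_add, pow_zero, mul_one] at this
    rw [this]
  · rw [Z_eq_Z_add hn hx r e k, ← hceil]
    exact antitone_Z_ceil hn hx _ (Nat.le_add_right k e)

theorem isTestIdeal_iff (hn : ringKrullDim R = n) (hx : Ideal.span (Set.range x) = maximalIdeal R)
    {I : Ideal R} : IsTestIdeal p x (Ideal.span {f}) I ↔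
      ∃ N ∈ family p x f, I = N.annihilator := by
  constructor
  · rintro ⟨c, -, rfl⟩
    exact ⟨_, iInf_Z_ceil_mem_family hn hx c, rfl⟩
  · rintro ⟨_, ⟨r, e, he, rfl⟩, rfl⟩
    exact ⟨(r : ℝ) / (p : ℝ) ^ e, by positivity, by rw [testIdeal, iInf_Z_ceil_eq hn hx r he]⟩

end TestIdeals

end

end FThresh

theorem mainTheorem8 {R : Type*} [CommRing R] [IsRegularLocalRing R]
    (p : ℕ) [Fact p.Prime] [CharP R p]
    {n : ℕ} (hn : ringKrullDim R = n)
    (x : Fin n → R) (hx : Ideal.span (Set.range x) = maximalIdeal R)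
    (f : R) (hf0 : f ≠ 0) (hf : f ∈ maximalIdeal R) :
    -- the chain `M_0 ⊊ M_1 ⊊ ⋯` is well defined
    (IsChain (· ≤ ·) (FThresh.family p x f) ∧
      FThresh.M p x f 0 = ⊥ ∧
      (∀ m : ℕ, IsLeast {N | N ∈ FThresh.family p x f ∧ ∀ j < m, N ≠ FThresh.M p x f j}
        (FThresh.M p x f m)) ∧
      StrictMono (FThresh.M p x f)) ∧
    -- the numbers `ν_i(e)`, `ν_f^{J_i}(p^e)` and `c_i = c^{J_i}(f)` are well defined
    (FThresh.J p x f 0 = ⊤ ∧ FThresh.fThreshold p (Ideal.span {f}) (FThresh.J p x f 0) = 0 ∧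
      ∀ i : ℕ, 1 ≤ i →
        (Ideal.span {f} ≤ (FThresh.J p x f i).radical ∧
          (FThresh.J p x f i).radical ≤ maximalIdeal R) ∧
        (∀ e : ℕ, 1 ≤ e →
          IsGreatest {r : ℕ | FThresh.Z p x (Ideal.span {f}) r e ≤ FThresh.M p x f (i - 1)}
            (FThresh.nuChain p x f i e)) ∧
        (∀ e : ℕ, 1 ≤ e →
          IsGreatest {r : ℕ | ¬ Ideal.span {f} ^ r ≤
              FThresh.frobPower (FThresh.J p x f i) (p ^ e)}
            (FThresh.nu (Ideal.span {f}) (FThresh.J p x f i) (p ^ e))) ∧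
        Tendsto (fun e : ℕ =>
            (FThresh.nu (Ideal.span {f}) (FThresh.J p x f i) (p ^ e) : ℝ) / (p : ℝ) ^ e) atTop
          (𝓝 (FThresh.fThreshold p (Ideal.span {f}) (FThresh.J p x f i)))) ∧
    -- (1)
    (((frobenius R p).Finite ∨ IsAdicComplete (maximalIdeal R) R) →
      ∀ i : ℕ, 1 ≤ i →
        Tendsto (fun e : ℕ => (FThresh.nuChain p x f i e : ℝ) / (p : ℝ) ^ e) atTop
          (𝓝 (FThresh.fThreshold p (Ideal.span {f}) (FThresh.J p x f i)))) ∧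
    -- (2)
    ((∀ i : ℕ, FThresh.IsTestIdeal p x (Ideal.span {f}) (FThresh.J p x f i)) ∧
      ∀ I : Ideal R, FThresh.IsTestIdeal p x (Ideal.span {f}) I →
        (∀ i : ℕ, I ≠ FThresh.J p x f i) → ∀ i : ℕ, I ≤ FThresh.J p x f i) := by

  have hL := FThresh.isLeast_M (p := p) hn hx hf0 hf
  have hJ0 : FThresh.J p x f 0 = ⊤ := by
    rw [FThresh.J, FThresh.M_zero hn hx hf0 hf, Submodule.annihilator_bot]
  have hlim := fun (i : ℕ) (hi : 1 ≤ i) => FThresh.tendsto_nu_div_fThreshold p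
    (FThresh.J_ne_top (p := p) hn hx hf0 hf hi) (FThresh.mem_radical_J hn hx hf0 hf i)
  refine ⟨⟨fun N hN N' hN' _ => FThresh.family_le_or_le hn hx N hN N' hN',
    FThresh.M_zero hn hx hf0 hf, hL, FThresh.strictMono_of_isLeast hL⟩,
    ⟨hJ0, by rw [hJ0, FThresh.fThreshold_top], fun i hi => ⟨⟨?_, ?_⟩, ?_, ?_, hlim i hi⟩⟩, ?_, ?_, ?_⟩
  · exact (Ideal.span_singleton_le_iff_mem _).mpr (FThresh.mem_radical_J hn hx hf0 hf i)
  · exact le_maximalIdeal fun h => FThresh.J_ne_top hn hx hf0 hf hi (Ideal.radical_eq_top.mp h)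
  · exact fun e _ => FThresh.isGreatest_nuChain hn hx hf0 hf hi e
  · exact fun e _ => FThresh.isGreatest_nu (FThresh.J_ne_top hn hx hf0 hf hi)
      (FThresh.mem_radical_J hn hx hf0 hf i) (pow_ne_zero e (Fact.out : p.Prime).ne_zero)
  · intro h i hi
    -- The two sequences are identified only for e ≥ 1, since the family contains Z_{r,e} only for
    -- such e.
    refine (hlim i hi).congr' ((eventually_ge_atTop 1).mono fun e he => ?_)
    beta_reduce
    rw [FThresh.nuChain_eq_nu hn hx hf0 hf hi
      (FThresh.mem_M_of_forall_J_smul_eq_zero hn hx hf0 hf h i) he]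
  · exact fun i => (FThresh.isTestIdeal_iff hn hx).mpr ⟨_, (hL i).1.1, rfl⟩
  · intro I hI hne i
    obtain ⟨N, hN, rfl⟩ := (FThresh.isTestIdeal_iff hn hx).mp hI
    -- The test ideal is Ann N with N different from every M_j, so N competes in the minimum
    -- defining M_i and M_i ≤ N.
    exact Submodule.annihilator_mono ((hL i).2 ⟨hN, fun j _ h => hne j (by rw [h, FThresh.J])⟩)
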